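/- Let $\rho>0$ and let $K\subset\{x\in\mathbb R^3:\ |x|\le\rho\}$ be a (bounded) open set with $C^\infty$ boundary; put $\Omega=\mathbb R^3\setminus\bar K$, and for $x\in\partial\Omega=\partial K$ let $\nu(x)$ be the unit normal pointing into $K$. Let $$G\begin{pmatrix}E\\B\end{pmatrix}=\begin{pmatrix}\operatorname{curl}B\\-\operatorname{curl}E\end{pmatrix},\qquad A(\xi)\begin{pmatrix}E\\B\end{pmatrix}=\begin{pmatrix}\xi\wedge B\\-\xi\wedge E\end{pmatrix}\quad(\xi\in\mathbb R^3)$$ be the Maxwell operator on $\mathbb C^6$-valued fields and its symbol. Let $\mathcal N(x)\subset\mathbb C^6$ be linear subspaces depending smoothly on $x\in\partial\Omega$ such that $\langle A(\nu(x))u,u\rangle\le 0$ for all $u\in\mathcal N(x)$ and such that $\mathcal N(x)$ is maximal with this property (a maximal dissipative boundary condition). Let $G_b$ be the operator in $H=L^2(\Omega;\mathbb C^6)$ whose graph is the closure in $H\times H$ of $\{(f,Gf)\}$, where $f$ runs over the restrictions to $\bar\Omega$ of compactly supported $C^1$ functions on $\mathbb R^3$ with $f(x)\in\mathcal N(x)$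 for all $x\in\partial\Omega$; that is, $D(G_b)$ is the closure of these $f$ in the graph norm. Let $\lambda\in\mathbb C$ with $\operatorname{Re}\lambda<0$. There is a constant $C$, depending only on $\rho$ and $\lambda$, such that every $g\in D(G_b)$ with $G_bg=\lambda g$ has a representative that is continuous on $\Omega$ and, denoting this representative again by $g$, $$|g(x)|\le C\,e^{(\operatorname{Re}\lambda)|x|}\,\|g\|_{L^2(\Omega)}\qquad\text{for all } |x|\ge 3\rho .$$ In particular $g(x)=\mathcal O\big(e^{(\operatorname{Re}\lambda)|x|}\big)$ as $|x|\to\infty$. -/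

import Mathlib

open Set Filter Topology MeasureTheory
open scoped ContDiff Matrix

noncomputable section

/-- Euclidean space `ℝ³`. -/
abbrev R3 : Type := EuclideanSpace ℝ (Fin 3)

/-- The fibre `ℂ⁶ = ℂ³ ⊕ ℂ³`: the `inl` coordinates are those of the electric field `E`, the `inr`
coordinates those of the magnetic field `B`. -/
abbrev C6 : Type := EuclideanSpace ℂ (Fin 3 ⊕ Fin 3)

/-! ### The obstacle and its exterior -/

/-- `ψ` is a smooth defining function of `K` on the open neighbourhood `U` of `x`. -/
structure IsLocalDefiningFunction (K : Set R3) (x : R3) (U : Set R3) (ψ : R3 → ℝ) : Prop where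
  isOpen : IsOpen U
  mem : x ∈ U
  smooth : ContDiffOn ℝ ∞ ψ U
  regular : gradient ψ x ≠ 0
  mem_iff : ∀ y ∈ U, y ∈ K ↔ ψ y < 0

/-- The boundary of the open set `K` is a smooth surface with `K` locally on one side. -/
def HasSmoothBoundary (K : Set R3) : Prop :=
  ∀ x ∈ frontier K, ∃ U ψ, IsLocalDefiningFunction K x U ψ

/-- `ν` is the unit normal to `∂K` at `x` that points into `K`. -/
def IsUnitNormalInto (K : Set R3) (x ν : R3) : Prop :=
  ∃ U ψ, IsLocalDefiningFunction K x U ψ ∧ ν = -(‖gradient ψ x‖⁻¹ • gradient ψ x)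

/-- The exterior domain `Ω = ℝ³ \ K̄`. -/
def exteriorOf (K : Set R3) : Set R3 := (closure K)ᶜ

/-! ### The Maxwell system -/

/-- The matrix of `v ↦ ξ ∧ v`. -/
def crossMatrix (ξ : R3) : Matrix (Fin 3) (Fin 3) ℂ :=
  !![0, -(ξ 2 : ℂ), (ξ 1 : ℂ);
     (ξ 2 : ℂ), 0, -(ξ 0 : ℂ);
     -(ξ 1 : ℂ), (ξ 0 : ℂ), 0]

/-- The symbol `A(ξ) = ∑ ξ_j A_j` of the Maxwell system, `A(ξ) (E, B) = (ξ ∧ B, - ξ ∧ E)`. -/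
def maxwellSymbol (ξ : R3) : C6 →L[ℂ] C6 :=
  Matrix.toEuclideanCLM (𝕜 := ℂ) (Matrix.fromBlocks 0 (crossMatrix ξ) (-crossMatrix ξ) 0)

/-- The constant coefficient operator `G = ∑ A_j ∂_j`, that is `G (E, B) = (curl B, - curl E)`,
acting on classically differentiable fields. -/
def maxwellG (u : R3 → C6) (x : R3) : C6 :=
  ∑ j : Fin 3, maxwellSymbol (EuclideanSpace.single j 1)
    (fderiv ℝ u x (EuclideanSpace.single j 1))

/-! ### Dissipative boundary conditions -/

/-- `𝒩(x)` depends smoothly on `x ∈ ∂K`: near every boundary point it has a smooth frame. -/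
def IsSmoothBoundaryBundle (K : Set R3) (N : R3 → Submodule ℂ C6) : Prop :=
  ∀ x₀ ∈ frontier K, ∃ (U : Set R3) (k : ℕ) (b : Fin k → R3 → C6),
    IsOpen U ∧ x₀ ∈ U ∧ (∀ i, ContDiffOn ℝ ∞ (b i) U) ∧
    ∀ x ∈ U ∩ frontier K,
      LinearIndependent ℂ (fun i => b i x) ∧ N x = Submodule.span ℂ (range fun i => b i x)

/-- The quadratic form `⟨A(ν) u, u⟩` is nonpositive on `M`. -/
def IsDissipativeFor (ν : R3) (M : Submodule ℂ C6) : Prop :=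
  ∀ u ∈ M, (inner ℂ (maxwellSymbol ν u) u).re ≤ 0

/-- At each boundary point, `𝒩(x)` is a maximal subspace among those on which
`⟨A(ν(x)) u, u⟩ ≤ 0`, where `ν(x)` is the unit normal pointing into `K`. -/
def IsMaximalDissipative (K : Set R3) (N : R3 → Submodule ℂ C6) : Prop :=
  ∀ x ∈ frontier K, ∀ ν, IsUnitNormalInto K x ν → Maximal (IsDissipativeFor ν) (N x)

/-! ### The operator `G_b` -/

/-- The Hilbert space `H = L²(Ω; ℂ⁶)`. -/
abbrev HilbertOf (K : Set R3) : Type := Lp C6 2 (volume.restrict (exteriorOf K))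

/-- The classical fields in the core of `G_b`: restrictions to `Ω̄` of compactly supported `C¹`
functions on `ℝ³` that satisfy `u(x) ∈ 𝒩(x)` on `∂Ω`. -/
structure IsClassicalField (K : Set R3) (N : R3 → Submodule ℂ C6) (f : R3 → C6) : Prop where
  contDiff : ContDiff ℝ 1 f
  compact : HasCompactSupport f
  boundary : ∀ x ∈ frontier (exteriorOf K), f x ∈ N x

lemma maxwellG_add {f g : R3 → C6} (hf : ContDiff ℝ 1 f) (hg : ContDiff ℝ 1 g) :
    maxwellG (f + g) = maxwellG f + maxwellG g := by
  funext x
  simp only [maxwellG, Pi.add_apply]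
  rw [← Finset.sum_add_distrib]
  refine Finset.sum_congr rfl fun j _ => ?_
  rw [fderiv_add (hf.differentiable one_ne_zero x) (hg.differentiable one_ne_zero x)]
  simp

lemma maxwellG_smul (c : ℂ) {f : R3 → C6} (hf : ContDiff ℝ 1 f) :
    maxwellG (c • f) = c • maxwellG f := by
  funext x
  simp only [maxwellG, Pi.smul_apply]
  rw [Finset.smul_sum]
  refine Finset.sum_congr rfl fun j _ => ?_
  rw [fderiv_const_smul (hf.differentiable one_ne_zero x)]
  simp

lemma maxwellG_zero : maxwellG (0 : R3 → C6) = 0 := by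
  funext x
  simp [maxwellG]

/-- The graph `{(f, G f)}` in `H × H` of the classical operator. -/
def classicalGraph (K : Set R3) (N : R3 → Submodule ℂ C6) :
    Submodule ℂ (HilbertOf K × HilbertOf K) where
  carrier := {p | ∃ f : R3 → C6, IsClassicalField K N f ∧
    p.1 =ᵐ[volume.restrict (exteriorOf K)] f ∧
    p.2 =ᵐ[volume.restrict (exteriorOf K)] maxwellG f}
  add_mem' := by
    rintro p q ⟨f, hf, hf1, hf2⟩ ⟨g, hg, hg1, hg2⟩
    refine ⟨f + g, ⟨hf.contDiff.add hg.contDiff, hf.compact.add hg.compact, fun x hx =>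
      (N x).add_mem (hf.boundary x hx) (hg.boundary x hx)⟩, ?_, ?_⟩
    · exact (Lp.coeFn_add _ _).trans (hf1.add hg1)
    · rw [maxwellG_add hf.contDiff hg.contDiff]
      exact (Lp.coeFn_add _ _).trans (hf2.add hg2)
  zero_mem' := by
    refine ⟨0, ⟨contDiff_const, HasCompactSupport.zero, fun x _ => (N x).zero_mem⟩, ?_, ?_⟩
    · exact Lp.coeFn_zero _ _ _
    · rw [maxwellG_zero]
      exact Lp.coeFn_zero _ _ _
  smul_mem' := by
    rintro c p ⟨f, hf, hf1, hf2⟩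
    refine ⟨c • f, ⟨hf.contDiff.const_smul c, hf.compact.smul_left (f := fun _ => c), fun x hx =>
      (N x).smul_mem c (hf.boundary x hx)⟩, ?_, ?_⟩
    · exact (Lp.coeFn_smul _ _).trans (hf1.const_smul c)
    · rw [maxwellG_smul c hf.contDiff]
      exact (Lp.coeFn_smul _ _).trans (hf2.const_smul c)

/-- The generator `G_b`: the domain is the closure of the classical fields in the graph norm, and
`G_b` is the corresponding closed extension of `G`. -/
def maxwellGb (K : Set R3) (N : R3 → Submodule ℂ C6) : HilbertOf K →ₗ.[ℂ] HilbertOf K :=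
  (classicalGraph K N).topologicalClosure.toLinearPMap

lemma inner_maxwellSymbol (ξ : R3) (v w : C6) :
    inner ℂ v (maxwellSymbol ξ w) = inner ℂ (maxwellSymbol ξ v) w := by
  have h : ContinuousLinearMap.adjoint (maxwellSymbol ξ) = maxwellSymbol ξ := by
    have hX : (crossMatrix ξ)ᴴ = -crossMatrix ξ := by
      ext i j
      fin_cases i <;> fin_cases j <;> simp [crossMatrix]
    rw [← ContinuousLinearMap.star_eq_adjoint]
    unfold maxwellSymbol
    rw [← map_star, Matrix.star_eq_conjTranspose, Matrix.fromBlocks_conjTranspose]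
    simp [hX]
  rw [← ContinuousLinearMap.adjoint_inner_left, h]

/-- Integration by parts against a test function supported in `Ω`. -/
lemma classicalGraph_weak {K : Set R3} {N : R3 → Submodule ℂ C6} {g : R3 → ℝ}
    (hg : ContDiff ℝ ∞ g) (hgc : HasCompactSupport g) (hgs : tsupport g ⊆ exteriorOf K) (v : C6)
    {f : R3 → C6} (hf : IsClassicalField K N f) :
    ∫ x in exteriorOf K, inner ℂ (g x • v) (maxwellG f x) =
      -∫ x in exteriorOf K, inner ℂ (∑ j : Fin 3,
        fderiv ℝ g x (EuclideanSpace.single j 1) •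
          maxwellSymbol (EuclideanSpace.single j 1) v) (f x) := by
  have hg1 : ContDiff ℝ 1 g := hg.of_le (by exact_mod_cast le_top)
  have hgd : Continuous (fderiv ℝ g) := hg1.continuous_fderiv one_ne_zero
  have hfd : Continuous (fderiv ℝ f) := hf.contDiff.continuous_fderiv one_ne_zero
  have hfc : Continuous f := hf.contDiff.continuous
  have hz : ∀ x, x ∉ exteriorOf K → g x = 0 := fun x hx =>
    image_eq_zero_of_notMem_tsupport fun h => hx (hgs h)
  have hzd : ∀ x, x ∉ exteriorOf K → fderiv ℝ g x = 0 := fun x hx =>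
    fderiv_of_notMem_tsupport ℝ fun h => hx (hgs h)
  rw [setIntegral_eq_integral_of_forall_compl_eq_zero
      (fun x hx => by rw [hz x hx, zero_smul, inner_zero_left]),
    setIntegral_eq_integral_of_forall_compl_eq_zero
      (fun x hx => by simp [hzd x hx])]
  let L : Fin 3 → C6 →L[ℝ] ℂ := fun j =>
    (innerSL ℂ (maxwellSymbol (EuclideanSpace.single j 1) v)).restrictScalars ℝ
  have hL : ∀ j x, fderiv ℝ (fun y => L j (f y)) x = (L j).comp (fderiv ℝ f x) := fun j x =>
    ((L j).hasFDerivAt.comp x (hf.contDiff.differentiable one_ne_zero x).hasFDerivAt).fderiv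
  have e1 : ∀ x, inner ℂ (g x • v) (maxwellG f x) =
      ∑ j : Fin 3, g x • fderiv ℝ (fun y => L j (f y)) x (EuclideanSpace.single j 1) := by
    intro x
    rw [maxwellG, inner_sum]
    refine Finset.sum_congr rfl fun j _ => ?_
    rw [hL, ← Complex.coe_smul, inner_smul_left, inner_maxwellSymbol]
    simp [L]
  have e2 : ∀ x, inner ℂ (∑ j : Fin 3, fderiv ℝ g x (EuclideanSpace.single j 1) •
      maxwellSymbol (EuclideanSpace.single j 1) v) (f x) =
      ∑ j : Fin 3, fderiv ℝ g x (EuclideanSpace.single j 1) • L j (f x) := by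
    intro x
    rw [sum_inner]
    refine Finset.sum_congr rfl fun j _ => ?_
    rw [← Complex.coe_smul, inner_smul_left]
    simp [L]
  have i1 : ∀ j, Integrable fun x =>
      g x • fderiv ℝ (fun y => L j (f y)) x (EuclideanSpace.single j 1) := by
    intro j
    refine Continuous.integrable_of_hasCompactSupport ?_ hgc.smul_right
    simp only [hL]
    fun_prop
  have i2 : ∀ j, Integrable fun x =>
      fderiv ℝ g x (EuclideanSpace.single j 1) • L j (f x) := by
    intro j
    refine Continuous.integrable_of_hasCompactSupport ?_
      (hgc.fderiv_apply ℝ (EuclideanSpace.single j 1)).smul_right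
    fun_prop
  have i3 : ∀ j, Integrable fun x => g x • L j (f x) := by
    intro j
    refine Continuous.integrable_of_hasCompactSupport ?_ hgc.smul_right
    have := hg.continuous
    fun_prop
  simp only [e1, e2]
  rw [integral_finsetSum _ fun j _ => i1 j, integral_finsetSum _ fun j _ => i2 j,
    ← Finset.sum_neg_distrib]
  refine Finset.sum_congr rfl fun j _ => ?_
  exact integral_smul_fderiv_eq_neg_fderiv_smul_of_integrable (i2 j) (i1 j) (i3 j)
    (fun x _ => hg1.differentiable one_ne_zero x)
    (fun x _ => (L j).differentiableAt.comp x (hf.contDiff.differentiable one_ne_zero x))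

/-- `G_b` is single valued: the classical operator is closable. -/
lemma classicalGraph_closure_fst_eq_zero (K : Set R3) (N : R3 → Submodule ℂ C6)
    (p : HilbertOf K × HilbertOf K) (hp : p ∈ (classicalGraph K N).topologicalClosure)
    (hp0 : p.1 = 0) : p.2 = 0 := by
  have hΩ : IsOpen (exteriorOf K) := isClosed_closure.isOpen_compl
  have key : ∀ (v : C6) (g : R3 → ℝ), ContDiff ℝ ∞ g → HasCompactSupport g →
      tsupport g ⊆ exteriorOf K → ∫ x in exteriorOf K, g x • inner ℂ v (p.2 x) = 0 := by
    intro v g hg hgc hgs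
    have hg1 : ContDiff ℝ 1 g := hg.of_le (by exact_mod_cast le_top)
    have hgd : Continuous (fderiv ℝ g) := hg1.continuous_fderiv one_ne_zero
    have hgcont : Continuous g := hg.continuous
    have m1 : MemLp (fun x => g x • v) 2 (volume.restrict (exteriorOf K)) :=
      ((by fun_prop : Continuous fun x => g x • v).memLp_of_hasCompactSupport
        hgc.smul_right).restrict _
    have m2 : MemLp (fun x => ∑ j : Fin 3, fderiv ℝ g x (EuclideanSpace.single j 1) •
        maxwellSymbol (EuclideanSpace.single j 1) v) 2 (volume.restrict (exteriorOf K)) := by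
      refine memLp_finsetSum _ fun j _ => MemLp.restrict _ ?_
      exact (by fun_prop : Continuous fun x => fderiv ℝ g x (EuclideanSpace.single j 1) •
        maxwellSymbol (EuclideanSpace.single j 1) v).memLp_of_hasCompactSupport
          (hgc.fderiv_apply ℝ (EuclideanSpace.single j 1)).smul_right
    let S : Set (HilbertOf K × HilbertOf K) :=
      {q | inner ℂ (m1.toLp _) q.2 = -inner ℂ (m2.toLp _) q.1}
    have hS : IsClosed S := isClosed_eq (by fun_prop) (by fun_prop)
    have hsub : (classicalGraph K N : Set (HilbertOf K × HilbertOf K)) ⊆ S := by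
      rintro q ⟨f, hf, hf1, hf2⟩
      change inner ℂ (m1.toLp _) q.2 = -inner ℂ (m2.toLp _) q.1
      rw [L2.inner_def, L2.inner_def]
      have h := classicalGraph_weak hg hgc hgs v hf
      refine Eq.trans ?_ (h.trans ?_)
      · refine integral_congr_ae ?_
        filter_upwards [hf2, m1.coeFn_toLp] with x hx1 hx2
        rw [hx1, hx2]
      · refine congrArg Neg.neg (integral_congr_ae ?_)
        filter_upwards [hf1, m2.coeFn_toLp] with x hx1 hx2
        rw [hx1, hx2]
    have hpS : p ∈ S := closure_minimal hsub hS hp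
    have hpS' : inner ℂ (m1.toLp _) p.2 = -inner ℂ (m2.toLp _) p.1 := hpS
    rw [hp0, inner_zero_right, neg_zero, L2.inner_def] at hpS'
    rw [← hpS']
    refine integral_congr_ae ?_
    filter_upwards [m1.coeFn_toLp] with x hx
    rw [hx, ← Complex.coe_smul (g x) v, inner_smul_left]
    simp
  have hloc : ∀ v : C6, ∀ᵐ x ∂(volume.restrict (exteriorOf K)), inner ℂ v (p.2 x) = 0 := by
    intro v
    rw [ae_restrict_iff' hΩ.measurableSet]
    have hl : LocallyIntegrableOn (fun x => inner ℂ v (p.2 x)) (exteriorOf K) := by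
      have h2 : MemLp (fun x => inner ℂ v (p.2 x)) 2 (volume.restrict (exteriorOf K)) :=
        (Lp.memLp p.2).const_inner v
      exact locallyIntegrableOn_of_locallyIntegrable_restrict (h2.locallyIntegrable (by norm_num))
    refine hΩ.ae_eq_zero_of_integral_contDiff_smul_eq_zero hl fun g hg hgc hgs => ?_
    rw [← key v g hg hgc hgs]
    refine (setIntegral_eq_integral_of_forall_compl_eq_zero fun x hx => ?_).symm
    rw [image_eq_zero_of_notMem_tsupport fun h => hx (hgs h), zero_smul]
  rw [Lp.eq_zero_iff_ae_eq_zero]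
  have hall := ae_all_iff.2 fun i : Fin 3 ⊕ Fin 3 => hloc (EuclideanSpace.single i 1)
  filter_upwards [hall] with x hx
  ext i
  have hi := hx i
  rw [EuclideanSpace.inner_single_left] at hi
  simpa using hi

/-- The graph of `G_b` is the closure in `H × H` of the graph of the classical operator. -/
lemma maxwellGb_graph (K : Set R3) (N : R3 → Submodule ℂ C6) :
    (maxwellGb K N).graph = (classicalGraph K N).topologicalClosure :=
  Submodule.toLinearPMap_graph_eq _ fun p hp hp0 =>
    classicalGraph_closure_fst_eq_zero K N p hp hp0

end

/-! The boundary condition plays no role in the decay. Test functions supported in `Ω` turn `G_b g =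
λ g` into a weak Maxwell system there, since integration by parts survives passage to the closure of
the classical graph. As `λ ≠ 0`, the identity div curl = 0 makes both fields divergence free, and
then `λ² g = G² g = Δ g` weakly (`IsWeakMaxwell.isWeakHelmholtz`).

The Helmholtz equation has the radial solution `e^{λ s} / s`, which decays because `Re λ < 0`.
Testing against a cutoff `X` times this kernel gives a Green formula (`ae_eq_integral_commKernel`):
off the support of `∇X`, `X g` is a constant times the integral of `g` against a kernel living on
the support of `∇X`. To have smooth test functions, the distance `s` is replaced by `√(ε² + s²)`.
The resulting error in the Helmholtz equation, `ε²` times `prof₂`, is an approximate identity as `ε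
→ 0` (`tendsto_integral_mollifier`) and produces the value of `X g`.

The formula is used twice. With `X = 1` near a point, its right side is continuous there, whence the
continuous representative. With `X` vanishing near the obstacle and equal to `1` on a long shell,
`∇X` lives in the ball of radius `2ρ` and far away (`exists_ae_decay`). The near part is at distance
at least `|x| - 2ρ` from `x`, which gives `e^{Re λ |x|}` times an L¹ norm over a fixed ball,
controlled by Cauchy–Schwarz. The far part is bounded by a tail of an integrable function and
disappears in the limit. The constants come from the fixed cutoffs, `ρ` and `λ`, never from `K`. -/

noncomputable section

/-! ### Partial derivatives -/

/-- The `j`-th partial derivative. -/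
def pd {E : Type*} [NormedAddCommGroup E] [NormedSpace ℝ E] (j : Fin 3) (f : R3 → E) (x : R3) : E :=
  fderiv ℝ f x (EuclideanSpace.single j 1)

/-- The Laplacian of a complex valued function. -/
def lap (f : R3 → ℂ) (x : R3) : ℂ := ∑ j, pd j (pd j f) x

lemma pd_contDiff {E : Type*} [NormedAddCommGroup E] [NormedSpace ℝ E] (j : Fin 3) {f : R3 → E}
    (hf : ContDiff ℝ ∞ f) : ContDiff ℝ ∞ (pd j f) :=
  (hf.fderiv_right (m := ∞) (by simp)).clm_apply contDiff_const

lemma lap_contDiff {f : R3 → ℂ} (hf : ContDiff ℝ ∞ f) : ContDiff ℝ ∞ (lap f) :=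
  ContDiff.sum fun j _ => pd_contDiff j (pd_contDiff j hf)

lemma tsupport_pd_subset {E : Type*} [NormedAddCommGroup E] [NormedSpace ℝ E] (j : Fin 3)
    (f : R3 → E) : tsupport (pd j f) ⊆ tsupport f :=
  tsupport_fderiv_apply_subset ℝ _

lemma pd_eq_zero_of_notMem {E : Type*} [NormedAddCommGroup E] [NormedSpace ℝ E] (j : Fin 3)
    {f : R3 → E} {x : R3} (hx : x ∉ tsupport f) : pd j f x = 0 :=
  image_eq_zero_of_notMem_tsupport fun h => hx (tsupport_pd_subset j f h)

/-- The support of the derivative, not of `f`, is what counts: cutoffs will be used where they are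
locally constant but nonzero. -/
lemma lap_eq_zero_of_notMem {f : R3 → ℂ} {x : R3} (hx : x ∉ tsupport (fderiv ℝ f)) :
    lap f x = 0 := by
  refine Finset.sum_eq_zero fun j _ => pd_eq_zero_of_notMem j fun h => hx ?_
  refine closure_mono ?_ h
  intro y hy h0
  exact hy (by simp [pd, h0])

lemma pd_eq_zero_of_notMem_fderiv {f : R3 → ℂ} {x : R3} (j : Fin 3)
    (hx : x ∉ tsupport (fderiv ℝ f)) : pd j f x = 0 := by
  simp [pd, image_eq_zero_of_notMem_tsupport hx]

lemma pd_mul (j : Fin 3) {f g : R3 → ℂ} {x : R3} (hf : DifferentiableAt ℝ f x)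
    (hg : DifferentiableAt ℝ g x) :
    pd j (fun y => f y * g y) x = f x * pd j g x + pd j f x * g x := by
  simp [pd, fderiv_fun_mul hf hg, mul_comm]

lemma pd_add (j : Fin 3) {f g : R3 → ℂ} {x : R3} (hf : DifferentiableAt ℝ f x)
    (hg : DifferentiableAt ℝ g x) :
    pd j (fun y => f y + g y) x = pd j f x + pd j g x := by
  simp [pd, fderiv_fun_add hf hg]

lemma lap_mul {f g : R3 → ℂ} (hf : ContDiff ℝ ∞ f) (hg : ContDiff ℝ ∞ g) (x : R3) :
    lap (fun y => f y * g y) x =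
      f x * lap g x + 2 * ∑ j, pd j f x * pd j g x + lap f x * g x := by
  have d : ∀ {h : R3 → ℂ}, ContDiff ℝ ∞ h → ∀ y, DifferentiableAt ℝ h y := fun hh y =>
    hh.differentiable (by simp) y
  simp only [lap, Finset.mul_sum, Finset.sum_mul, ← Finset.sum_add_distrib]
  refine Finset.sum_congr rfl fun j _ => ?_
  have e : pd j (fun y => f y * g y) = fun y => f y * pd j g y + pd j f y * g y :=
    funext fun y => pd_mul j (d hf y) (d hg y)
  rw [e, pd_add j, pd_mul j (d hf x) (d (pd_contDiff j hg) x),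
    pd_mul j (d (pd_contDiff j hf) x) (d hg x)]
  · ring
  · exact (d hf x).mul (d (pd_contDiff j hg) x)
  · exact (d (pd_contDiff j hf) x).mul (d hg x)

/-! ### The regularised fundamental solution -/

/-- The regularised norm `(ε² + |z|²)^{1/2}`. -/
def regNorm (ε : ℝ) (z : R3) : ℝ := √(ε ^ 2 + ‖z‖ ^ 2)

lemma regNorm_zero (z : R3) : regNorm 0 z = ‖z‖ := by simp [regNorm]

lemma regNorm_sq (ε : ℝ) (z : R3) : regNorm ε z ^ 2 = ε ^ 2 + ‖z‖ ^ 2 :=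
  Real.sq_sqrt (by positivity)

lemma regNorm_pos {ε : ℝ} (hε : 0 < ε) (z : R3) : 0 < regNorm ε z :=
  Real.sqrt_pos.2 (by positivity)

lemma continuous_regNorm : Continuous fun p : ℝ × R3 => regNorm p.1 p.2 := by
  unfold regNorm
  fun_prop

lemma contDiff_regNorm {ε : ℝ} (hε : 0 < ε) (x : R3) :
    ContDiff ℝ ∞ fun y => regNorm ε (y - x) := by
  unfold regNorm
  refine ContDiff.sqrt (contDiff_const.add ((contDiff_id.sub contDiff_const).norm_sq ℝ))
    fun y => ?_
  positivity

/-- The profile `s⁻¹ e^{λ s}` of the fundamental solution. -/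
def prof (lam : ℂ) (s : ℝ) : ℂ := Complex.exp (lam * s) * (s : ℂ)⁻¹

/-- `s⁻¹` times the derivative of `prof`. -/
def prof₁ (lam : ℂ) (s : ℝ) : ℂ :=
  Complex.exp (lam * s) * (lam * (s : ℂ)⁻¹ ^ 2 - (s : ℂ)⁻¹ ^ 3)

/-- `s⁻¹` times the derivative of `prof₁`. -/
def prof₂ (lam : ℂ) (s : ℝ) : ℂ :=
  Complex.exp (lam * s) * (lam ^ 2 * (s : ℂ)⁻¹ ^ 3 - 3 * lam * (s : ℂ)⁻¹ ^ 4 + 3 * (s : ℂ)⁻¹ ^ 5)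

lemma hasDerivAt_exp_mul (lam : ℂ) (s : ℝ) :
    HasDerivAt (fun s : ℝ => Complex.exp (lam * s)) (Complex.exp (lam * s) * lam) s := by
  have h := ((hasDerivAt_id s).ofReal_comp.const_mul lam).cexp
  simpa using h

lemma hasDerivAt_ofReal_inv {s : ℝ} (hs : s ≠ 0) :
    HasDerivAt (fun s : ℝ => (s : ℂ)⁻¹) (-((s : ℂ)⁻¹ ^ 2)) s := by
  have h := (hasDerivAt_id s).ofReal_comp.fun_inv (by simpa using hs)
  refine h.congr_deriv ?_
  simp [div_eq_mul_inv]

/-- Writing derivatives as `s` times the next profile suits radial functions: `∂_j s = (y_j - x_j) /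
s`, so the factor `s` cancels and each partial derivative is a coordinate times the next profile. -/
lemma hasDerivAt_prof (lam : ℂ) {s : ℝ} (hs : s ≠ 0) :
    HasDerivAt (prof lam) (s * prof₁ lam s) s := by
  refine ((hasDerivAt_exp_mul lam s).mul (hasDerivAt_ofReal_inv hs)).congr_deriv ?_
  have : (s : ℂ) ≠ 0 := by exact_mod_cast hs
  unfold prof₁
  field_simp
  ring

lemma hasDerivAt_prof₁ (lam : ℂ) {s : ℝ} (hs : s ≠ 0) :
    HasDerivAt (prof₁ lam) (s * prof₂ lam s) s := by
  refine ((hasDerivAt_exp_mul lam s).mul ((((hasDerivAt_ofReal_inv hs).fun_pow 2).const_mul lam).sub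
    ((hasDerivAt_ofReal_inv hs).fun_pow 3))).congr_deriv ?_
  have : (s : ℂ) ≠ 0 := by exact_mod_cast hs
  unfold prof₂
  simp only [Nat.cast_ofNat, Pi.sub_apply, Nat.reduceSub, pow_one]
  field_simp
  ring

lemma contDiff_ofReal_comp {f : R3 → ℝ} (hf : ContDiff ℝ ∞ f) :
    ContDiff ℝ ∞ fun y => (f y : ℂ) :=
  Complex.ofRealCLM.contDiff.comp hf

lemma contDiff_prof_regNorm (lam : ℂ) {ε : ℝ} (hε : 0 < ε) (x : R3) :
    ContDiff ℝ ∞ fun y => prof lam (regNorm ε (y - x)) := by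
  have h := contDiff_ofReal_comp (contDiff_regNorm hε x)
  unfold prof
  refine ContDiff.mul (contDiff_const.mul h).cexp (h.inv fun y => ?_)
  exact_mod_cast (regNorm_pos hε _).ne'

lemma contDiff_prof₁_regNorm (lam : ℂ) {ε : ℝ} (hε : 0 < ε) (x : R3) :
    ContDiff ℝ ∞ fun y => prof₁ lam (regNorm ε (y - x)) := by
  have h := contDiff_ofReal_comp (contDiff_regNorm hε x)
  have h' : ContDiff ℝ ∞ fun y => ((regNorm ε (y - x) : ℝ) : ℂ)⁻¹ :=
    h.inv fun y => by exact_mod_cast (regNorm_pos hε _).ne'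
  unfold prof₁
  exact ContDiff.mul (contDiff_const.mul h).cexp ((contDiff_const.mul (h'.pow 2)).sub (h'.pow 3))

/-- Partial derivatives of a radial function. -/
lemma pd_comp_regNorm {f : ℝ → ℂ} {f' : ℂ} {ε : ℝ} (hε : 0 < ε) (x y : R3) (j : Fin 3)
    (hf : HasDerivAt f (regNorm ε (y - x) * f') (regNorm ε (y - x))) :
    pd j (fun y => f (regNorm ε (y - x))) y = ((y j - x j : ℝ) : ℂ) * f' := by
  have hs := regNorm_pos hε (y - x)
  have h1 : HasFDerivAt (fun y => ε ^ 2 + ‖y - x‖ ^ 2) (2 • innerSL ℝ (y - x)) y := by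
    have := ((hasFDerivAt_id y).sub_const x).norm_sq
    simpa using this.const_add (ε ^ 2)
  have h2 := h1.sqrt (by positivity)
  have h3 : HasFDerivAt (fun y => f (regNorm ε (y - x))) _ y :=
    HasFDerivAt.comp y hf.hasFDerivAt h2
  rw [pd, h3.fderiv]
  have h4 : √(ε ^ 2 + ‖y - x‖ ^ 2) = regNorm ε (y - x) := rfl
  have h5 : (regNorm ε (y - x) : ℂ) ≠ 0 := by exact_mod_cast hs.ne'
  simp [h4, EuclideanSpace.inner_single_right]
  field_simp

lemma pd_coord (j : Fin 3) (x y : R3) :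
    pd j (fun y => ((y j - x j : ℝ) : ℂ)) y = 1 := by
  have h : HasFDerivAt (fun y : R3 => ((y j - x j : ℝ) : ℂ))
      (Complex.ofRealCLM.comp (EuclideanSpace.proj j : R3 →L[ℝ] ℝ)) y :=
    Complex.ofRealCLM.hasFDerivAt.comp y
      ((EuclideanSpace.proj j : R3 →L[ℝ] ℝ).hasFDerivAt.sub_const (x j))
  rw [pd, h.fderiv]
  simp

lemma pd_prof (lam : ℂ) {ε : ℝ} (hε : 0 < ε) (x y : R3) (j : Fin 3) :
    pd j (fun y => prof lam (regNorm ε (y - x))) y =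
      ((y j - x j : ℝ) : ℂ) * prof₁ lam (regNorm ε (y - x)) :=
  pd_comp_regNorm hε x y j (hasDerivAt_prof lam (regNorm_pos hε _).ne')

/-- The regularised fundamental solution solves the Helmholtz equation up to a concentrated
kernel. -/
lemma lap_prof (lam : ℂ) {ε : ℝ} (hε : 0 < ε) (x y : R3) :
    lap (fun y => prof lam (regNorm ε (y - x))) y =
      lam ^ 2 * prof lam (regNorm ε (y - x)) - (ε : ℂ) ^ 2 * prof₂ lam (regNorm ε (y - x)) := by
  have h1 : ∀ j, pd j (pd j (fun y => prof lam (regNorm ε (y - x)))) y =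
      ((y j - x j : ℝ) : ℂ) ^ 2 * prof₂ lam (regNorm ε (y - x)) +
        prof₁ lam (regNorm ε (y - x)) := by
    intro j
    rw [show pd j (fun y => prof lam (regNorm ε (y - x))) = fun y =>
      ((y j - x j : ℝ) : ℂ) * prof₁ lam (regNorm ε (y - x)) from
      funext fun y => pd_prof lam hε x y j, pd_mul, pd_coord,
      pd_comp_regNorm hε x y j (hasDerivAt_prof₁ lam (regNorm_pos hε _).ne')]
    · ring
    · refine (contDiff_ofReal_comp (f := fun y : R3 => y j - x j) ?_).differentiable (by simp) y
      fun_prop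
    · exact (contDiff_prof₁_regNorm lam hε x).differentiable (by simp) y
  -- The regularisation enters only here. Since `s² prof₂ + 3 prof₁ = λ² prof`, the `-ε²` is the
  -- entire defect in the Helmholtz equation.
  have h2 : ∑ j, ((y j - x j : ℝ) : ℂ) ^ 2 = (regNorm ε (y - x) : ℂ) ^ 2 - (ε : ℂ) ^ 2 := by
    have := regNorm_sq ε (y - x)
    rw [EuclideanSpace.norm_sq_eq] at this
    have h : ∑ j, (y j - x j) ^ 2 = regNorm ε (y - x) ^ 2 - ε ^ 2 := by
      simpa using (eq_sub_iff_add_eq'.2 this.symm)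
    exact_mod_cast h
  simp only [lap, h1, Finset.sum_add_distrib, ← Finset.sum_mul, h2]
  have h5 : (regNorm ε (y - x) : ℂ) ≠ 0 := by exact_mod_cast (regNorm_pos hε _).ne'
  simp only [Finset.sum_const, Finset.card_univ, Fintype.card_fin, nsmul_eq_mul, Nat.cast_ofNat]
  unfold prof prof₁ prof₂
  field_simp
  ring

/-! ### Weak solutions of the Helmholtz equation -/

/-- `w` is a weak solution of `Δ w = κ w` in `Ω`. -/
def IsWeakHelmholtz (κ : ℂ) (Ω : Set R3) (w : R3 → C6) : Prop :=
  ∀ φ : R3 → ℂ, ContDiff ℝ ∞ φ → HasCompactSupport φ → tsupport φ ⊆ Ω →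
    ∫ y, (lap φ y - κ * φ y) • w y = 0

/-- The kernel obtained by commuting the Helmholtz operator with the cutoff `X`. -/
def commKernel (lam : ℂ) (X : R3 → ℂ) (ε : ℝ) (x y : R3) : ℂ :=
  lap X y * prof lam (regNorm ε (y - x)) +
    2 * ∑ j, pd j X y * (((y j - x j : ℝ) : ℂ) * prof₁ lam (regNorm ε (y - x)))

lemma commKernel_eq_zero {lam : ℂ} {X : R3 → ℂ} {ε : ℝ} {x y : R3}
    (hy : y ∉ tsupport (fderiv ℝ X)) : commKernel lam X ε x y = 0 := by
  simp [commKernel, lap_eq_zero_of_notMem hy, pd_eq_zero_of_notMem_fderiv _ hy]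

lemma contDiff_prof₂_regNorm (lam : ℂ) {ε : ℝ} (hε : 0 < ε) (x : R3) :
    ContDiff ℝ ∞ fun y => prof₂ lam (regNorm ε (y - x)) := by
  have h := contDiff_ofReal_comp (contDiff_regNorm hε x)
  have h' : ContDiff ℝ ∞ fun y => ((regNorm ε (y - x) : ℝ) : ℂ)⁻¹ :=
    h.inv fun y => by exact_mod_cast (regNorm_pos hε _).ne'
  unfold prof₂
  exact ContDiff.mul (contDiff_const.mul h).cexp (((contDiff_const.mul (h'.pow 3)).sub
    (contDiff_const.mul (h'.pow 4))).add (contDiff_const.mul (h'.pow 5)))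

lemma integrable_smul_of_tsupport {w : R3 → C6} (hw : LocallyIntegrable w) {f : R3 → ℂ}
    (hf : Continuous f) (hc : HasCompactSupport f) : Integrable fun y => f y • w y :=
  hw.integrable_smul_left_of_hasCompactSupport hf hc

/-- The weak equation is tested with `X` times the regularised solution. By the product rule the
`λ²` terms cancel; what is left is the commutator terms carrying derivatives of `X`, minus the
defect of the regularised solution times `X`. -/
lemma integral_mollifier_eq_commKernel {lam : ℂ} {Ω : Set R3} {w : R3 → C6}
    (hw : LocallyIntegrable w) (hweak : IsWeakHelmholtz (lam ^ 2) Ω w) {X : R3 → ℂ}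
    (hX : ContDiff ℝ ∞ X) (hXc : HasCompactSupport X) (hXs : tsupport X ⊆ Ω) {ε : ℝ}
    (hε : 0 < ε) (x : R3) :
    ∫ y, ((ε : ℂ) ^ 2 * prof₂ lam (regNorm ε (y - x))) • X y • w y =
      ∫ y, commKernel lam X ε x y • w y := by
  have hP := contDiff_prof_regNorm lam hε x
  have hXP := hX.mul hP
  have h0 := hweak _ hXP (hXc.mul_right) ((tsupport_mul_subset_left).trans hXs)
  have e : ∀ y, lap (fun y => X y * prof lam (regNorm ε (y - x))) y -
      lam ^ 2 * (X y * prof lam (regNorm ε (y - x))) =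
      commKernel lam X ε x y - ((ε : ℂ) ^ 2 * prof₂ lam (regNorm ε (y - x))) * X y := by
    intro y
    rw [lap_mul hX hP, lap_prof lam hε]
    simp only [pd_prof lam hε, commKernel]
    ring
  have i2 : Integrable fun y => (((ε : ℂ) ^ 2 * prof₂ lam (regNorm ε (y - x))) * X y) • w y :=
    integrable_smul_of_tsupport hw ((continuous_const.mul
      (contDiff_prof₂_regNorm lam hε x).continuous).mul hX.continuous) hXc.mul_left
  have hK : Continuous fun y => commKernel lam X ε x y := by
    have h1 := (contDiff_prof_regNorm lam hε x).continuous
    have h2 := (contDiff_prof₁_regNorm lam hε x).continuous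
    have h3 := (lap_contDiff hX).continuous
    have h4 := fun j => (pd_contDiff j hX).continuous
    unfold commKernel
    fun_prop
  have i1 : Integrable fun y => commKernel lam X ε x y • w y := by
    refine integrable_smul_of_tsupport hw hK (HasCompactSupport.intro hXc fun y hy => ?_)
    exact commKernel_eq_zero fun h => hy (tsupport_fderiv_subset ℝ h)
  have e2 : ∀ y, (lap (fun y => X y * prof lam (regNorm ε (y - x))) y -
      lam ^ 2 * (X y * prof lam (regNorm ε (y - x)))) • w y =
      commKernel lam X ε x y • w y - (((ε : ℂ) ^ 2 * prof₂ lam (regNorm ε (y - x))) * X y) • w y :=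
    fun y => by rw [e, sub_smul]
  rw [funext e2, integral_sub i1 i2, sub_eq_zero] at h0
  rw [h0]
  simp only [mul_smul]

/-! ### The approximate identity -/

lemma norm_exp_mul_ofReal (lam : ℂ) (s : ℝ) :
    ‖Complex.exp (lam * s)‖ = Real.exp (lam.re * s) := by
  rw [Complex.norm_exp]; simp

/-- The constant in the bound of `prof₂`. -/
def profBound (lam : ℂ) : ℝ :=
  ‖lam‖ ^ 2 * (2 / lam.re ^ 2) + 3 * ‖lam‖ * (1 / |lam.re|) + 3

lemma profBound_nonneg (lam : ℂ) : 0 ≤ profBound lam := by unfold profBound; positivity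

lemma exp_mul_le {a s : ℝ} (ha : a < 0) (hs : 0 ≤ s) :
    Real.exp (a * s) * s ≤ 1 / |a| ∧ Real.exp (a * s) * s ^ 2 ≤ 2 / a ^ 2 := by
  have hp : 0 ≤ -a * s := mul_nonneg (by linarith) hs
  have h1 : -a * s ≤ Real.exp (-a * s) := by linarith [Real.add_one_le_exp (-a * s)]
  have h2 : (-a * s) ^ 2 / 2 ≤ Real.exp (-a * s) := by
    linarith [Real.quadratic_le_exp_of_nonneg hp]
  have h3 : Real.exp (a * s) * Real.exp (-a * s) = 1 := by rw [← Real.exp_add]; simp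
  have h4 := Real.exp_pos (a * s)
  constructor
  · rw [abs_of_neg ha, le_div_iff₀ (by linarith)]
    calc Real.exp (a * s) * s * -a = Real.exp (a * s) * (-a * s) := by ring
      _ ≤ _ := (mul_le_mul_of_nonneg_left h1 h4.le).trans h3.le
  · have ha' := ha.ne
    rw [le_div_iff₀ (by positivity)]
    have := (mul_le_mul_of_nonneg_left h2 h4.le).trans h3.le
    nlinarith

/-- The exponential absorbs the factors `s` and `s²` by which the lower order terms exceed `s⁻⁵` at
infinity. A pure power is needed so that the bound scales exactly under dilation. -/
lemma norm_prof₂_le {lam : ℂ} (hlam : lam.re < 0) {s : ℝ} (hs : 0 < s) :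
    ‖prof₂ lam s‖ ≤ profBound lam * s⁻¹ ^ 5 := by
  obtain ⟨h1, h2⟩ := exp_mul_le hlam hs.le
  have h0 : Real.exp (lam.re * s) ≤ 1 := Real.exp_le_one_iff.2 (by nlinarith)
  have hn : ‖lam ^ 2 * (s : ℂ)⁻¹ ^ 3 - 3 * lam * (s : ℂ)⁻¹ ^ 4 + 3 * (s : ℂ)⁻¹ ^ 5‖ ≤
      ‖lam‖ ^ 2 * s⁻¹ ^ 3 + 3 * ‖lam‖ * s⁻¹ ^ 4 + 3 * s⁻¹ ^ 5 := by
    refine (norm_add_le _ _).trans (add_le_add ((norm_sub_le _ _).trans (add_le_add ?_ ?_)) ?_) <;>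
    simp [abs_of_pos hs]
  rw [prof₂, norm_mul, norm_exp_mul_ofReal]
  refine (mul_le_mul_of_nonneg_left hn (Real.exp_pos _).le).trans ?_
  have e : Real.exp (lam.re * s) * (‖lam‖ ^ 2 * s⁻¹ ^ 3 + 3 * ‖lam‖ * s⁻¹ ^ 4 + 3 * s⁻¹ ^ 5) =
      (‖lam‖ ^ 2 * (Real.exp (lam.re * s) * s ^ 2) + 3 * ‖lam‖ * (Real.exp (lam.re * s) * s) +
        3 * Real.exp (lam.re * s)) * s⁻¹ ^ 5 := by
    field_simp
  rw [e, profBound]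
  gcongr
  linarith

lemma regNorm_smul {ε : ℝ} (hε : 0 ≤ ε) (z : R3) : regNorm ε (ε • z) = ε * regNorm 1 z := by
  unfold regNorm
  rw [norm_smul, Real.norm_of_nonneg hε, show ε ^ 2 + (ε * ‖z‖) ^ 2 = ε ^ 2 * (1 ^ 2 + ‖z‖ ^ 2) by
    ring, Real.sqrt_mul (by positivity), Real.sqrt_sq hε]

lemma continuous_regNorm_right (ε : ℝ) : Continuous (regNorm ε) :=
  continuous_regNorm.comp (by fun_prop : Continuous fun z : R3 => (ε, z))

lemma integrable_inv_regNorm : Integrable fun z : R3 => (regNorm 1 z)⁻¹ ^ 5 := by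
  have h := integrable_rpow_neg_one_add_norm_sq (E := R3) (μ := volume) (r := 5)
    (by norm_num [finrank_euclideanSpace])
  refine h.congr (Eventually.of_forall fun z => ?_)
  have hz : (0 : ℝ) ≤ 1 + ‖z‖ ^ 2 := by positivity
  simp only [regNorm, one_pow]
  rw [Real.sqrt_eq_rpow, ← Real.rpow_neg hz, ← Real.rpow_natCast _ 5, ← Real.rpow_mul hz]
  norm_num

/-- The total mass of the limit of the concentrated kernels. -/
def kernelMass : ℝ := ∫ z : R3, 3 * (regNorm 1 z)⁻¹ ^ 5

/-- The mass is `4π`, but only its positivity is used. -/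
lemma kernelMass_pos : 0 < kernelMass := by
  unfold kernelMass
  have hp : ∀ z : R3, 0 < 3 * (regNorm 1 z)⁻¹ ^ 5 := fun z => by
    have := regNorm_pos one_pos z
    positivity
  rw [integral_pos_iff_support_of_nonneg (fun z => (hp z).le) (integrable_inv_regNorm.const_mul 3)]
  rw [show Function.support (fun z : R3 => 3 * (regNorm 1 z)⁻¹ ^ 5) = univ from
    eq_univ_of_forall fun z => (hp z).ne']
  simp

/-- The concentrated kernel, rescaled to unit size. -/
def scaledKernel (lam : ℂ) (ε : ℝ) (z : R3) : ℂ := (ε : ℂ) ^ 5 * prof₂ lam (ε * regNorm 1 z)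

lemma norm_scaledKernel_le {lam : ℂ} (hlam : lam.re < 0) {ε : ℝ} (hε : 0 < ε) (z : R3) :
    ‖scaledKernel lam ε z‖ ≤ profBound lam * (regNorm 1 z)⁻¹ ^ 5 := by
  have hz := regNorm_pos one_pos z
  have h := norm_prof₂_le hlam (mul_pos hε hz)
  rw [scaledKernel, norm_mul, norm_pow, Complex.norm_real, Real.norm_of_nonneg hε.le]
  refine (mul_le_mul_of_nonneg_left h (by positivity)).trans (le_of_eq ?_)
  field_simp

/-- After multiplication by `ε⁵` the terms of `prof₂` containing `λ` keep a positive power of `ε`,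
and the exponential tends to `1`; only the `3 s⁻⁵` term survives. -/
lemma tendsto_scaledKernel (lam : ℂ) (z : R3) :
    Tendsto (fun ε => scaledKernel lam ε z) (𝓝[>] 0) (𝓝 ((3 * (regNorm 1 z)⁻¹ ^ 5 : ℝ) : ℂ)) := by
  have hz : (regNorm 1 z : ℂ) ≠ 0 := by exact_mod_cast (regNorm_pos one_pos z).ne'
  have hc : Continuous fun ε : ℝ => Complex.exp (lam * (ε * regNorm 1 z : ℝ)) *
      (lam ^ 2 * ε ^ 2 * (regNorm 1 z : ℂ)⁻¹ ^ 3 - 3 * lam * ε * (regNorm 1 z : ℂ)⁻¹ ^ 4 + 3 * (regNorm 1 z : ℂ)⁻¹ ^ 5) := by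
    fun_prop
  have h := (hc.tendsto 0).mono_left (nhdsWithin_le_nhds (s := Ioi 0))
  have e0 : ((3 * (regNorm 1 z)⁻¹ ^ 5 : ℝ) : ℂ) = Complex.exp (lam * (0 * regNorm 1 z : ℝ)) *
      (lam ^ 2 * (0 : ℝ) ^ 2 * (regNorm 1 z : ℂ)⁻¹ ^ 3 - 3 * lam * (0 : ℝ) * (regNorm 1 z : ℂ)⁻¹ ^ 4 +
        3 * (regNorm 1 z : ℂ)⁻¹ ^ 5) := by
    simp
  rw [e0]
  refine h.congr' ?_
  filter_upwards [self_mem_nhdsWithin] with ε hε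
  have hε' : (ε : ℂ) ≠ 0 := by exact_mod_cast (mem_Ioi.1 hε).ne'
  simp only [scaledKernel, prof₂]
  push_cast
  field_simp

lemma continuous_scaledKernel (lam : ℂ) {ε : ℝ} (hε : 0 < ε) :
    Continuous (scaledKernel lam ε) := by
  have h : Continuous fun z : R3 => ((ε * regNorm 1 z : ℝ) : ℂ) := by
    have := continuous_regNorm_right 1
    fun_prop
  have h' : Continuous fun z : R3 => ((ε * regNorm 1 z : ℝ) : ℂ)⁻¹ := h.inv₀ fun z => by
    exact_mod_cast (mul_pos hε (regNorm_pos one_pos z)).ne'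
  unfold scaledKernel prof₂
  fun_prop

/-- Substitute `x = y + ε z`: the Jacobian `ε³` joins the factor `ε²`, which explains the power `ε⁵`
in `scaledKernel`. -/
lemma integral_mollifier_eq_scaled (lam : ℂ) {ε : ℝ} (hε : 0 < ε) (φ : R3 → ℂ) (y : R3) :
    ∫ x, φ x * ((ε : ℂ) ^ 2 * prof₂ lam (regNorm ε (y - x))) =
      ∫ z, φ (y + ε • z) * scaledKernel lam ε z := by
  rw [← integral_add_left_eq_self _ y]
  have h := Measure.integral_comp_smul (volume : Measure R3)
    (fun t => φ (y + t) * ((ε : ℂ) ^ 2 * prof₂ lam (regNorm ε (y - (y + t))))) ε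
  have e : ∀ z : R3, φ (y + ε • z) * scaledKernel lam ε z = (ε : ℂ) ^ 3 *
      (φ (y + ε • z) * ((ε : ℂ) ^ 2 * prof₂ lam (regNorm ε (y - (y + ε • z))))) := by
    intro z
    have : regNorm ε (y - (y + ε • z)) = ε * regNorm 1 z := by
      rw [← regNorm_smul hε.le, sub_add_cancel_left]
      simp [regNorm]
    rw [this, scaledKernel]
    ring
  have hε' : (ε : ℂ) ≠ 0 := by exact_mod_cast hε.ne'
  rw [funext e, integral_const_mul, h, finrank_euclideanSpace, Fintype.card_fin,
    abs_of_pos (by positivity), Complex.real_smul, ← mul_assoc,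
    show (ε : ℂ) ^ 3 * ((ε ^ 3)⁻¹ : ℝ) = 1 by push_cast; field_simp, one_mul]

/-- The concentrated kernels form an approximate identity of mass `kernelMass`. -/
lemma tendsto_integral_mollifier {lam : ℂ} (hlam : lam.re < 0) {φ : R3 → ℂ} (hφ : Continuous φ)
    (hφc : HasCompactSupport φ) {u : R3 → C6} (hu : Integrable u) :
    Tendsto (fun ε : ℝ => ∫ x, φ x • ∫ y, ((ε : ℂ) ^ 2 * prof₂ lam (regNorm ε (y - x))) • u y)
      (𝓝[>] 0) (𝓝 ((kernelMass : ℂ) • ∫ x, φ x • u x)) := by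
  obtain ⟨M, hM⟩ := hφc.exists_bound_of_continuous hφ
  have hM0 : 0 ≤ M := (norm_nonneg _).trans (hM 0)
  -- Fubini moves the averaging from the merely integrable `u` to the continuous `φ`, whose averages
  -- converge at every point.
  have swap : ∀ ε : ℝ, 0 < ε →
      ∫ x, φ x • ∫ y, ((ε : ℂ) ^ 2 * prof₂ lam (regNorm ε (y - x))) • u y =
        ∫ y, (∫ z, φ (y + ε • z) * scaledKernel lam ε z) • u y := by
    intro ε hε
    simp only [← integral_mollifier_eq_scaled lam hε φ, ← integral_smul, ← integral_smul_const]
    rw [integral_integral_swap]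
    · simp only [mul_smul]
    · have h1 : Integrable (fun p : R3 × R3 => φ p.1 • u p.2) (volume.prod volume) :=
        (hφ.integrable_of_hasCompactSupport hφc).smul_prod hu
      have hr : Continuous fun p : R3 × R3 => ((regNorm ε (p.2 - p.1) : ℝ) : ℂ) := by
        have := continuous_regNorm_right ε
        fun_prop
      have hr' : Continuous fun p : R3 × R3 => ((regNorm ε (p.2 - p.1) : ℝ) : ℂ)⁻¹ :=
        hr.inv₀ fun p => by exact_mod_cast (regNorm_pos hε _).ne'
      have h2 : Continuous fun p : R3 × R3 =>
          (ε : ℂ) ^ 2 * prof₂ lam (regNorm ε (p.2 - p.1)) := by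
        unfold prof₂
        fun_prop
      -- For fixed `ε` the kernel is bounded, because the regularised norm is at least `ε`.
      have h3 := h1.bdd_smul (ε ^ 2 * (profBound lam * ε⁻¹ ^ 5)) h2.aestronglyMeasurable
        (Eventually.of_forall fun p => by
          rw [norm_mul, norm_pow, Complex.norm_real, Real.norm_of_nonneg hε.le]
          refine mul_le_mul_of_nonneg_left ((norm_prof₂_le hlam (regNorm_pos hε _)).trans ?_)
            (by positivity)
          refine mul_le_mul_of_nonneg_left ?_ (profBound_nonneg _)
          have hp := regNorm_pos hε (p.2 - p.1)
          have : ε ≤ regNorm ε (p.2 - p.1) := Real.le_sqrt_of_sq_le (by simp)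
          gcongr)
      refine h3.congr (Eventually.of_forall fun p => ?_)
      simp only [Function.uncurry, smul_smul, Pi.smul_apply', mul_comm]
  have inner : ∀ y, Tendsto (fun ε : ℝ => ∫ z, φ (y + ε • z) * scaledKernel lam ε z) (𝓝[>] 0)
      (𝓝 ((kernelMass : ℂ) * φ y)) := by
    intro y
    have e : (kernelMass : ℂ) * φ y = ∫ z, φ y * ((3 * (regNorm 1 z)⁻¹ ^ 5 : ℝ) : ℂ) := by
      rw [integral_const_mul, integral_complex_ofReal, mul_comm]
      rfl
    rw [e]
    refine tendsto_integral_filter_of_dominated_convergence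
      (fun z => M * (profBound lam * (regNorm 1 z)⁻¹ ^ 5)) ?_ ?_
      ((integrable_inv_regNorm.const_mul _).const_mul _) ?_
    · filter_upwards [self_mem_nhdsWithin] with ε hε
      have := continuous_scaledKernel lam (mem_Ioi.1 hε)
      exact (by fun_prop : Continuous fun z =>
        φ (y + ε • z) * scaledKernel lam ε z).aestronglyMeasurable
    · filter_upwards [self_mem_nhdsWithin] with ε hε
      refine Eventually.of_forall fun z => ?_
      rw [norm_mul]
      exact mul_le_mul (hM _) (norm_scaledKernel_le hlam hε z) (norm_nonneg _) hM0
    · refine Eventually.of_forall fun z => Tendsto.mul ?_ (tendsto_scaledKernel lam z)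
      have h : Continuous fun ε : ℝ => φ (y + ε • z) := by fun_prop
      have := (h.tendsto 0).mono_left (nhdsWithin_le_nhds (s := Ioi 0))
      simpa using this
  have main : Tendsto (fun ε : ℝ => ∫ y, (∫ z, φ (y + ε • z) * scaledKernel lam ε z) • u y)
      (𝓝[>] 0) (𝓝 (∫ y, ((kernelMass : ℂ) * φ y) • u y)) := by
    refine tendsto_integral_filter_of_dominated_convergence
      (fun y => (∫ z : R3, M * (profBound lam * (regNorm 1 z)⁻¹ ^ 5)) * ‖u y‖) ?_ ?_
      (hu.norm.const_mul _) ?_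
    · filter_upwards [self_mem_nhdsWithin] with ε hε
      have := continuous_scaledKernel lam (mem_Ioi.1 hε)
      have hc : Continuous fun p : R3 × R3 => φ (p.1 + ε • p.2) * scaledKernel lam ε p.2 := by
        fun_prop
      exact (hc.stronglyMeasurable.integral_prod_right' (ν := volume)).aestronglyMeasurable.smul
        hu.aestronglyMeasurable
    · filter_upwards [self_mem_nhdsWithin] with ε hε
      refine Eventually.of_forall fun y => ?_
      rw [norm_smul]
      refine mul_le_mul_of_nonneg_right ?_ (norm_nonneg _)
      refine norm_integral_le_of_norm_le ((integrable_inv_regNorm.const_mul _).const_mul _)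
        (Eventually.of_forall fun z => ?_)
      rw [norm_mul]
      exact mul_le_mul (hM _) (norm_scaledKernel_le hlam hε z) (norm_nonneg _) hM0
    · exact Eventually.of_forall fun y => (inner y).smul_const _
  simp only [mul_smul, integral_smul] at main
  refine main.congr' ?_
  filter_upwards [self_mem_nhdsWithin] with ε hε
  exact (swap ε hε).symm

/-! ### The representation formula and interior regularity -/

/-- Either `y` lies in the support of `∇X`, hence differs from `x` and the kernel is nonsingular
even at `ε = 0`, or the kernel vanishes for all nearby `y`. -/
lemma continuousAt_commKernel (lam : ℂ) {X : R3 → ℂ} (hX : ContDiff ℝ ∞ X) (ε : ℝ) {x : R3}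
    (hx : x ∉ tsupport (fderiv ℝ X)) (y : R3) :
    ContinuousAt (fun q : (ℝ × R3) × R3 => commKernel lam X q.1.1 q.1.2 q.2) ((ε, x), y) := by
  by_cases hy : y ∈ tsupport (fderiv ℝ X)
  · have hne : ((regNorm ε (y - x) : ℝ) : ℂ) ≠ 0 := by
      have : 0 < ‖y - x‖ := norm_pos_iff.2 (sub_ne_zero.2 fun h => hx (h ▸ hy))
      have : 0 < regNorm ε (y - x) := Real.sqrt_pos.2 (by positivity)
      exact_mod_cast this.ne'
    have hs : Continuous fun q : (ℝ × R3) × R3 => ((regNorm q.1.1 (q.2 - q.1.2) : ℝ) : ℂ) := by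
      have := continuous_regNorm
      fun_prop
    have hs' : ContinuousAt (fun q : (ℝ × R3) × R3 =>
        ((regNorm q.1.1 (q.2 - q.1.2) : ℝ) : ℂ)⁻¹) ((ε, x), y) := hs.continuousAt.inv₀ hne
    have hs0 := hs.continuousAt (x := ((ε, x), y))
    have h3 := (lap_contDiff hX).continuous
    have h4 := fun j => (pd_contDiff j hX).continuous
    have h3' : ContinuousAt (fun q : (ℝ × R3) × R3 => lap X q.2) ((ε, x), y) :=
      (h3.comp continuous_snd).continuousAt
    have h4' : ∀ j, ContinuousAt (fun q : (ℝ × R3) × R3 => pd j X q.2) ((ε, x), y) := fun j =>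
      ((h4 j).comp continuous_snd).continuousAt
    have h5 : ∀ j : Fin 3, ContinuousAt
        (fun q : (ℝ × R3) × R3 => ((q.2 j - q.1.2 j : ℝ) : ℂ)) ((ε, x), y) := fun j =>
      (by fun_prop : Continuous fun q : (ℝ × R3) × R3 => ((q.2 j - q.1.2 j : ℝ) : ℂ)).continuousAt
    unfold commKernel prof prof₁
    fun_prop
  · have h : ∀ᶠ q : (ℝ × R3) × R3 in 𝓝 ((ε, x), y), q.2 ∉ tsupport (fderiv ℝ X) :=
      (continuous_snd.tendsto ((ε, x), y)).eventually
        ((isClosed_tsupport _).isOpen_compl.mem_nhds hy)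
    refine ContinuousAt.congr (f := fun _ => 0) continuousAt_const ?_
    filter_upwards [h] with q hq
    exact (commKernel_eq_zero hq).symm

/-- Joint continuity up to and including `ε = 0` serves two purposes: removing the regularisation,
and regularity in `x` of the limit formula. -/
lemma continuousOn_integral_commKernel (lam : ℂ) {w : R3 → C6} (hw : LocallyIntegrable w)
    {X : R3 → ℂ} (hX : ContDiff ℝ ∞ X) (hXc : HasCompactSupport X) :
    ContinuousOn (fun q : ℝ × R3 => ∫ y, commKernel lam X q.1 q.2 y • w y)
      (univ ×ˢ (tsupport (fderiv ℝ X))ᶜ) := by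
  refine (continuousOn_integral_bilinear_of_locally_integrable_of_compact_support (𝕜 := ℝ)
    (F := C6) (G := ℂ) (E := C6) (μ := volume) (g := w)
    (L := (ContinuousLinearMap.lsmul ℝ ℂ : ℂ →L[ℝ] C6 →L[ℝ] C6).flip)
    (f := fun q y => commKernel lam X q.1 q.2 y) (k := tsupport X)
    (s := univ ×ˢ (tsupport (fderiv ℝ X))ᶜ) hXc ?_ ?_ (hw.integrableOn_isCompact hXc)).congr
    fun q _ => by simp only [ContinuousLinearMap.flip_apply, ContinuousLinearMap.lsmul_apply]
  · rintro ⟨⟨ε, x⟩, y⟩ ⟨⟨-, hx⟩, -⟩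
    exact (continuousAt_commKernel lam hX ε hx y).continuousWithinAt
  · intro q y _ hy
    exact commKernel_eq_zero fun h => hy (tsupport_fderiv_subset ℝ h)

lemma continuousOn_integral_commKernel_zero (lam : ℂ) {w : R3 → C6} (hw : LocallyIntegrable w)
    {X : R3 → ℂ} (hX : ContDiff ℝ ∞ X) (hXc : HasCompactSupport X) :
    ContinuousOn (fun x => ∫ y, commKernel lam X 0 x y • w y) (tsupport (fderiv ℝ X))ᶜ := by
  have h1 := continuousOn_integral_commKernel lam hw hX hXc
  have h2 : ContinuousOn (fun x : R3 => ((0 : ℝ), x)) (tsupport (fderiv ℝ X))ᶜ := by fun_prop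
  have h3 := h1.comp h2 fun x hx => ⟨mem_univ _, hx⟩
  exact h3

lemma tendsto_integral_commKernel (lam : ℂ) {w : R3 → C6} (hw : LocallyIntegrable w)
    {X : R3 → ℂ} (hX : ContDiff ℝ ∞ X) (hXc : HasCompactSupport X) {φ : R3 → ℂ}
    (hφ : Continuous φ) (hφc : HasCompactSupport φ)
    (hφs : tsupport φ ⊆ (tsupport (fderiv ℝ X))ᶜ) :
    Tendsto (fun ε : ℝ => ∫ x, φ x • ∫ y, commKernel lam X ε x y • w y) (𝓝[>] 0)
      (𝓝 (∫ x, φ x • ∫ y, commKernel lam X 0 x y • w y)) := by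
  have hU : IsOpen (univ ×ˢ (tsupport (fderiv ℝ X))ᶜ : Set (ℝ × R3)) :=
    isOpen_univ.prod (isClosed_tsupport _).isOpen_compl
  have hc := continuousOn_integral_commKernel lam hw hX hXc
  have h : ContinuousOn (fun ε : ℝ => ∫ x, φ x • ∫ y, commKernel lam X ε x y • w y) univ := by
    refine continuousOn_integral_of_compact_support (k := tsupport φ) hφc ?_ ?_
    · refine Continuous.continuousOn (continuous_iff_continuousAt.2 ?_)
      rintro ⟨ε, x⟩
      by_cases hx : x ∈ tsupport φ
      · exact (hφ.comp continuous_snd).continuousAt.smul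
          (hc.continuousAt (hU.mem_nhds ⟨mem_univ _, hφs hx⟩))
      · have h : ∀ᶠ q : ℝ × R3 in 𝓝 (ε, x), q.2 ∉ tsupport φ :=
          (continuous_snd.tendsto (ε, x)).eventually
            ((isClosed_tsupport _).isOpen_compl.mem_nhds hx)
        refine ContinuousAt.congr (f := fun _ => 0) continuousAt_const ?_
        filter_upwards [h] with q hq
        simp [Function.uncurry, image_eq_zero_of_notMem_tsupport hq]
    · intro ε x _ hx
      simp [image_eq_zero_of_notMem_tsupport hx]
  exact ((h.continuousAt univ_mem).tendsto).mono_left nhdsWithin_le_nhds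

/-- Locally integrable functions with the same integrals against test functions agree a.e. -/
lemma ae_eq_of_integral_smul_eq {U : Set R3} (hU : IsOpen U) {f g : R3 → C6}
    (hf : LocallyIntegrableOn f U) (hg : LocallyIntegrableOn g U)
    (h : ∀ φ : R3 → ℝ, ContDiff ℝ ∞ φ → HasCompactSupport φ → tsupport φ ⊆ U →
      ∫ x, φ x • f x = ∫ x, φ x • g x) : ∀ᵐ x, x ∈ U → f x = g x := by
  have key : ∀ᵐ x, x ∈ U → (f - g) x = 0 := by
    refine hU.ae_eq_zero_of_integral_contDiff_smul_eq_zero (hf.sub hg) fun φ hφ hφc hφs => ?_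
    have aux : ∀ {k : R3 → C6}, LocallyIntegrableOn k U → Integrable fun x => φ x • k x := by
      intro k hk
      refine (integrableOn_iff_integrable_of_support_subset (s := tsupport φ) ?_).1 ?_
      · intro x hx
        by_contra hn
        exact hx (by simp [image_eq_zero_of_notMem_tsupport hn])
      · exact (hk.integrableOn_compact_subset hφs hφc).continuousOn_smul hφ.continuous.continuousOn
          hφc
    simp only [Pi.sub_apply, smul_sub]
    rw [integral_sub (aux hf) (aux hg), h φ hφ hφc hφs, sub_self]
  filter_upwards [key] with x hx hxU
  exact sub_eq_zero.1 (hx hxU)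

/-- Green's representation of a weak solution of the Helmholtz equation. -/
lemma ae_eq_integral_commKernel {lam : ℂ} (hlam : lam.re < 0) {Ω : Set R3} {w : R3 → C6}
    (hw : LocallyIntegrable w) (hweak : IsWeakHelmholtz (lam ^ 2) Ω w) {X : R3 → ℂ}
    (hX : ContDiff ℝ ∞ X) (hXc : HasCompactSupport X) (hXs : tsupport X ⊆ Ω) :
    ∀ᵐ x, x ∉ tsupport (fderiv ℝ X) →
      (kernelMass : ℂ) • X x • w x = ∫ y, commKernel lam X 0 x y • w y := by
  have hU : IsOpen (tsupport (fderiv ℝ X))ᶜ := (isClosed_tsupport _).isOpen_compl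
  have hu : Integrable fun x => X x • w x := integrable_smul_of_tsupport hw hX.continuous hXc
  have hc := continuousOn_integral_commKernel_zero lam hw hX hXc
  have hl := hc.locallyIntegrableOn (μ := volume) hU.measurableSet
  have hl' : LocallyIntegrableOn (fun x => (kernelMass : ℂ) • X x • w x)
      (tsupport (fderiv ℝ X))ᶜ := by
    have h : Integrable fun x => (kernelMass : ℂ) • X x • w x := hu.smul (kernelMass : ℂ)
    exact h.locallyIntegrable.locallyIntegrableOn _
  have key := ae_eq_of_integral_smul_eq hU hl' hl
  refine key fun φ hφ hφc hφs => ?_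
  have hφ' : Continuous fun x => (φ x : ℂ) := (contDiff_ofReal_comp hφ).continuous
  have hφc' : HasCompactSupport fun x => (φ x : ℂ) := hφc.comp_left (g := fun t : ℝ => (t : ℂ)) rfl
  have hts : tsupport (fun x => (φ x : ℂ)) ⊆ tsupport φ :=
    tsupport_comp_subset (g := fun t : ℝ => (t : ℂ)) rfl φ
  have l1 := tendsto_integral_mollifier hlam hφ' hφc' hu
  have l2 := tendsto_integral_commKernel lam hw hX hXc hφ' hφc' (hts.trans hφs)
  -- For `ε > 0` the two families of integrals coincide, so their limits do.
  have e := tendsto_nhds_unique (l1.congr' (by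
    filter_upwards [self_mem_nhdsWithin] with ε hε
    simp only [integral_mollifier_eq_commKernel hw hweak hX hXc hXs hε])) l2
  simp only [Complex.coe_smul] at e
  rw [← e, ← integral_smul]
  exact integral_congr_ae (Eventually.of_forall fun x => smul_comm (φ x) _ _)

lemma notMem_tsupport_fderiv {X : R3 → ℂ} {x : R3} {c : ℂ} (h : X =ᶠ[𝓝 x] fun _ => c) :
    x ∉ tsupport (fderiv ℝ X) := by
  rw [notMem_tsupport_iff_eventuallyEq]
  refine (h.fderiv (𝕜 := ℝ)).trans (Eventually.of_forall fun y => ?_)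
  simp

/-- Weak solutions of the Helmholtz equation are continuous near each point. -/
lemma exists_local_continuous_representative {lam : ℂ} (hlam : lam.re < 0) {Ω : Set R3}
    (hΩ : IsOpen Ω) {w : R3 → C6} (hw : LocallyIntegrable w)
    (hweak : IsWeakHelmholtz (lam ^ 2) Ω w) {x₀ : R3} (hx₀ : x₀ ∈ Ω) :
    ∃ (U : Set R3) (h : R3 → C6), IsOpen U ∧ x₀ ∈ U ∧ ContinuousOn h U ∧
      ∀ᵐ x, x ∈ U → w x = h x := by
  obtain ⟨r, hr, hrΩ⟩ := Metric.isOpen_iff.1 hΩ x₀ hx₀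
  -- Outer radius `r / 2` keeps the closed support inside the ball of radius `r`; on the ball of
  -- radius `r / 4` the gradient vanishes, so the representation applies there with `X = 1`.
  let b : ContDiffBump x₀ := ⟨r / 4, r / 2, by positivity, by linarith⟩
  let X : R3 → ℂ := fun y => (b y : ℂ)
  have hX : ContDiff ℝ ∞ X := contDiff_ofReal_comp b.contDiff
  have hXc : HasCompactSupport X := b.hasCompactSupport.comp_left (g := fun t : ℝ => (t : ℂ)) rfl
  have hXs : tsupport X ⊆ Ω := by
    refine Subset.trans (tsupport_comp_subset (g := fun t : ℝ => (t : ℂ)) rfl (b : R3 → ℝ)) ?_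
    · rw [b.tsupport_eq]
      exact (Metric.closedBall_subset_ball (by simp [b]; linarith)).trans hrΩ
  have hone : ∀ x ∈ Metric.ball x₀ (r / 4), X x = 1 := fun x hx => by
    simp only [X]
    rw [b.one_of_mem_closedBall (Metric.ball_subset_closedBall hx)]
    simp
  have hU : ∀ x ∈ Metric.ball x₀ (r / 4), x ∉ tsupport (fderiv ℝ X) := fun x hx =>
    notMem_tsupport_fderiv (c := 1) (Filter.eventually_of_mem (Metric.isOpen_ball.mem_nhds hx) hone)
  refine ⟨Metric.ball x₀ (r / 4),
    fun x => (kernelMass : ℂ)⁻¹ • ∫ y, commKernel lam X 0 x y • w y, Metric.isOpen_ball,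
    Metric.mem_ball_self (by positivity), ?_, ?_⟩
  · have h := (continuousOn_integral_commKernel_zero lam hw hX hXc).mono hU
    exact h.const_smul (kernelMass : ℂ)⁻¹
  · filter_upwards [ae_eq_integral_commKernel hlam hw hweak hX hXc hXs] with x hx hxU
    rw [← hx (hU x hxU), hone x hxU, one_smul, smul_smul, inv_mul_cancel₀, one_smul]
    exact_mod_cast kernelMass_pos.ne'

/-- A function that agrees a.e. with a continuous function near each point of an open set agrees
a.e. with a single continuous function. -/
lemma exists_continuousOn_ae_eq_of_local {Ω : Set R3} (hΩ : IsOpen Ω) {w : R3 → C6}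
    (hloc : ∀ x₀ ∈ Ω, ∃ (U : Set R3) (h : R3 → C6), IsOpen U ∧ x₀ ∈ U ∧ ContinuousOn h U ∧
      ∀ᵐ x, x ∈ U → w x = h x) :
    ∃ g' : R3 → C6, ContinuousOn g' Ω ∧ ∀ᵐ x, x ∈ Ω → w x = g' x := by
  choose! U h hUo hmem hcont hae using hloc
  -- Continuous functions equal a.e. on an open set are equal there, so the local choices are
  -- compatible and the diagonal `h x x` is a consistent gluing.
  have heq : ∀ x₀ ∈ Ω, ∀ x ∈ Ω, x ∈ U x₀ → h x x = h x₀ x := by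
    intro x₀ h₀ x hx hxU
    refine Measure.eqOn_open_of_ae_eq (μ := volume) (U := U x ∩ U x₀) ?_
      ((hUo x hx).inter (hUo x₀ h₀)) ((hcont x hx).mono inter_subset_left)
      ((hcont x₀ h₀).mono inter_subset_right) ⟨hmem x hx, hxU⟩
    rw [EventuallyEq, ae_restrict_iff' ((hUo x hx).inter (hUo x₀ h₀)).measurableSet]
    filter_upwards [hae x hx, hae x₀ h₀] with y h1 h2 hy
    rw [← h1 hy.1, h2 hy.2]
  refine ⟨fun x => h x x, fun x₀ h₀ => ?_, ?_⟩
  · have h1 : ContinuousAt (h x₀) x₀ := (hcont x₀ h₀).continuousAt ((hUo x₀ h₀).mem_nhds (hmem x₀ h₀))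
    refine (h1.congr ?_).continuousWithinAt
    filter_upwards [(hUo x₀ h₀).mem_nhds (hmem x₀ h₀), hΩ.mem_nhds h₀] with x hxU hx
    exact (heq x₀ h₀ x hx hxU).symm
  · rw [ae_iff]
    refine measure_null_of_locally_null _ fun x₀ hx₀ => ?_
    have h₀ : x₀ ∈ Ω := by
      by_contra hn
      exact hx₀ fun h => absurd h hn
    refine ⟨_, inter_mem_nhdsWithin _ ((hUo x₀ h₀).mem_nhds (hmem x₀ h₀)), ?_⟩
    refine measure_mono_null ?_ (ae_iff.1 (hae x₀ h₀))
    rintro x ⟨hx, hxU⟩ hcon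
    exact hx fun hxΩ => (hcon hxU).trans (heq x₀ h₀ x hxΩ hxU).symm

/-! ### From the Maxwell system to the Helmholtz equation -/

lemma maxwellSymbol_inl (ξ : R3) (v : C6) (i : Fin 3) :
    maxwellSymbol ξ v (Sum.inl i) = ∑ k, crossMatrix ξ i k * v (Sum.inr k) := by
  simp [maxwellSymbol, Matrix.ofLp_toEuclideanCLM, Matrix.mulVec, dotProduct, Matrix.fromBlocks]

lemma maxwellSymbol_inr (ξ : R3) (v : C6) (i : Fin 3) :
    maxwellSymbol ξ v (Sum.inr i) = -∑ k, crossMatrix ξ i k * v (Sum.inl k) := by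
  simp [maxwellSymbol, Matrix.ofLp_toEuclideanCLM, Matrix.mulVec, dotProduct, Matrix.fromBlocks]

/-- The divergence of a curl vanishes. -/
lemma div_maxwellSymbol_eq_zero {s : Fin 3 → Fin 3 → C6} (hs : ∀ i j, s i j = s j i) :
    (∑ j, ∑ i, maxwellSymbol (EuclideanSpace.single i 1) (s i j) (Sum.inl j) = 0) ∧
      ∑ j, ∑ i, maxwellSymbol (EuclideanSpace.single i 1) (s i j) (Sum.inr j) = 0 := by
  constructor
  · simp only [maxwellSymbol_inl]
    simp [Fin.sum_univ_three, crossMatrix, hs 1 0, hs 2 0, hs 2 1]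
    ring
  · simp only [maxwellSymbol_inr]
    simp [Fin.sum_univ_three, crossMatrix, hs 1 0, hs 2 0, hs 2 1]
    ring

/-- On divergence free fields the square of the Maxwell operator is the Laplacian. -/
lemma maxwellSymbol_sq {t : Fin 3 → Fin 3 → C6} (ht : ∀ i j, t i j = t j i)
    (hE : ∀ k, ∑ j, t j k (Sum.inl j) = 0) (hB : ∀ k, ∑ j, t j k (Sum.inr j) = 0) :
    ∑ k, maxwellSymbol (EuclideanSpace.single k 1)
      (∑ j, maxwellSymbol (EuclideanSpace.single j 1) (t j k)) = ∑ j, t j j := by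
  have hE0 := hE 0
  have hE1 := hE 1
  have hE2 := hE 2
  have hB0 := hB 0
  have hB1 := hB 1
  have hB2 := hB 2
  simp only [Fin.sum_univ_three, ht 1 0, ht 2 0, ht 2 1] at hE0 hE1 hE2 hB0 hB1 hB2
  ext i
  rcases i with i | i
  · simp only [WithLp.ofLp_sum, Finset.sum_apply, maxwellSymbol_inl, maxwellSymbol_inr]
    fin_cases i
    · simp [Fin.sum_univ_three, crossMatrix, ht 1 0, ht 2 0, ht 2 1]
      linear_combination -hE0
    · simp [Fin.sum_univ_three, crossMatrix, ht 1 0, ht 2 0, ht 2 1]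
      linear_combination -hE1
    · simp [Fin.sum_univ_three, crossMatrix, ht 1 0, ht 2 0, ht 2 1]
      linear_combination -hE2
  · simp only [WithLp.ofLp_sum, Finset.sum_apply, maxwellSymbol_inl, maxwellSymbol_inr]
    fin_cases i
    · simp [Fin.sum_univ_three, crossMatrix, ht 1 0, ht 2 0, ht 2 1]
      linear_combination -hB0
    · simp [Fin.sum_univ_three, crossMatrix, ht 1 0, ht 2 0, ht 2 1]
      linear_combination -hB1
    · simp [Fin.sum_univ_three, crossMatrix, ht 1 0, ht 2 0, ht 2 1]
      linear_combination -hB2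

lemma pd_comm {f : R3 → ℂ} (hf : ContDiff ℝ ∞ f) (i j : Fin 3) :
    pd i (pd j f) = pd j (pd i f) := by
  funext x
  have hs : IsSymmSndFDerivAt ℝ f x := hf.contDiffAt.isSymmSndFDerivAt (by
    rw [minSmoothness_of_isRCLikeNormedField]
    exact WithTop.coe_le_coe.2 le_top)
  have hd : DifferentiableAt ℝ (fderiv ℝ f) x :=
    (hf.fderiv_right (m := ∞) (by simp)).differentiable (by simp) x
  have e : ∀ a b : Fin 3, pd a (pd b f) x =
      fderiv ℝ (fderiv ℝ f) x (EuclideanSpace.single a 1) (EuclideanSpace.single b 1) := by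
    intro a b
    have h : pd b f = fun y => fderiv ℝ f y (EuclideanSpace.single b 1) := rfl
    rw [pd, h, fderiv_clm_apply hd (differentiableAt_const _)]
    simp
  rw [e, e]
  exact hs _ _

/-- `w` is a weak solution of `G w = λ w` in `Ω`. -/
def IsWeakMaxwell (lam : ℂ) (Ω : Set R3) (w : R3 → C6) : Prop :=
  ∀ φ : R3 → ℂ, ContDiff ℝ ∞ φ → HasCompactSupport φ → tsupport φ ⊆ Ω →
    lam • ∫ y, φ y • w y =
      -∑ j, maxwellSymbol (EuclideanSpace.single j 1) (∫ y, pd j φ y • w y)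

/-- All derivatives fall on the test function, so the classical computation becomes algebra on the
vectors `T (pd j (pd k φ))`, symmetric in `j` and `k`. -/
lemma IsWeakMaxwell.isWeakHelmholtz {lam : ℂ} (hlam : lam ≠ 0) {Ω : Set R3} {w : R3 → C6}
    (hw : LocallyIntegrable w) (h : IsWeakMaxwell lam Ω w) : IsWeakHelmholtz (lam ^ 2) Ω w := by
  intro φ hφ hφc hφs
  have c1 : ∀ {ψ : R3 → ℂ} (j : Fin 3), HasCompactSupport ψ → HasCompactSupport (pd j ψ) :=
    fun j hψ => hψ.of_isClosed_subset (isClosed_tsupport _) (tsupport_pd_subset j _)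
  have s1 : ∀ {ψ : R3 → ℂ} (j : Fin 3), tsupport ψ ⊆ Ω → tsupport (pd j ψ) ⊆ Ω :=
    fun j hψ => (tsupport_pd_subset j _).trans hψ
  let T : (R3 → ℂ) → C6 := fun ψ => ∫ y, ψ y • w y
  -- Weak vanishing of the divergences of `E` and `B`, tested with `pd k φ`: the equation turns `λ`
  -- times the divergence into the divergence of a curl, and `λ ≠ 0` is divided out.
  have hdiv : ∀ k, (∑ j, T (pd j (pd k φ)) (Sum.inl j) = 0) ∧
      ∑ j, T (pd j (pd k φ)) (Sum.inr j) = 0 := by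
    intro k
    have h1 : ∀ j, lam • T (pd j (pd k φ)) = -∑ i, maxwellSymbol (EuclideanSpace.single i 1)
        (T (pd i (pd j (pd k φ)))) := fun j =>
      h _ (pd_contDiff j (pd_contDiff k hφ)) (c1 j (c1 k hφc)) (s1 j (s1 k hφs))
    have h2 := div_maxwellSymbol_eq_zero (s := fun i j => T (pd i (pd j (pd k φ))))
      fun i j => by rw [pd_comm (pd_contDiff k hφ)]
    have h3 : ∀ a : Fin 3 → Fin 3 ⊕ Fin 3,
        ∑ j, ∑ i, maxwellSymbol (EuclideanSpace.single i 1) (T (pd i (pd j (pd k φ)))) (a j) = 0 →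
        ∑ j, T (pd j (pd k φ)) (a j) = 0 := by
      intro a ha
      refine (mul_eq_zero.1 (?_ : lam * _ = 0)).resolve_left hlam
      rw [Finset.mul_sum, ← neg_eq_zero, ← ha, ← Finset.sum_neg_distrib]
      refine Finset.sum_congr rfl fun j _ => ?_
      have := congrArg (fun v : C6 => v (a j)) (h1 j)
      simp only [PiLp.smul_apply, smul_eq_mul, PiLp.neg_apply, WithLp.ofLp_sum,
        Finset.sum_apply] at this
      rw [this, neg_neg]
    exact ⟨h3 _ h2.1, h3 _ h2.2⟩
  have h4 : ∀ k, lam • T (pd k φ) = -∑ j, maxwellSymbol (EuclideanSpace.single j 1)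
      (T (pd j (pd k φ))) := fun k => h _ (pd_contDiff k hφ) (c1 k hφc) (s1 k hφs)
  have h5 : lam • T φ = -∑ k, maxwellSymbol (EuclideanSpace.single k 1) (T (pd k φ)) :=
    h φ hφ hφc hφs
  have h6 := maxwellSymbol_sq (t := fun j k => T (pd j (pd k φ)))
    (fun i j => by rw [pd_comm hφ]) (fun k => (hdiv k).1) fun k => (hdiv k).2
  have h7 : lam ^ 2 • T φ = ∑ j, T (pd j (pd j φ)) := by
    rw [← h6, pow_two, mul_smul, h5, smul_neg, Finset.smul_sum, ← Finset.sum_neg_distrib]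
    refine Finset.sum_congr rfl fun k _ => ?_
    rw [← map_smul, h4, map_neg, neg_neg]
  have i1 : ∀ j, Integrable fun y => pd j (pd j φ) y • w y := fun j =>
    integrable_smul_of_tsupport hw (pd_contDiff j (pd_contDiff j hφ)).continuous (c1 j (c1 j hφc))
  have i2 : Integrable fun y => (lam ^ 2 * φ y) • w y :=
    integrable_smul_of_tsupport hw (continuous_const.mul hφ.continuous) hφc.mul_left
  simp only [sub_smul, lap, Finset.sum_smul]
  rw [integral_sub (integrable_finsetSum _ fun j _ => i1 j) i2,
    integral_finsetSum _ fun j _ => i1 j, sub_eq_zero]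
  refine h7.symm.trans ?_
  simp only [mul_smul, integral_smul]
  rfl

/-- Integration by parts passes to the closure of the classical graph. -/
lemma closure_classicalGraph_weak {K : Set R3} {N : R3 → Submodule ℂ C6} {φ : R3 → ℝ}
    (hφ : ContDiff ℝ ∞ φ) (hφc : HasCompactSupport φ) (hφs : tsupport φ ⊆ exteriorOf K) (v : C6)
    {p : HilbertOf K × HilbertOf K} (hp : p ∈ (classicalGraph K N).topologicalClosure) :
    ∫ x in exteriorOf K, inner ℂ (φ x • v) (p.2 x) =
      -∫ x in exteriorOf K, inner ℂ (∑ j : Fin 3, pd j φ x •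
          maxwellSymbol (EuclideanSpace.single j 1) v) (p.1 x) := by
  have hφ0 := hφ.continuous
  have hpd := fun j => (pd_contDiff j hφ).continuous
  have m1 : MemLp (fun x => φ x • v) 2 (volume.restrict (exteriorOf K)) :=
    ((by fun_prop : Continuous fun x => φ x • v).memLp_of_hasCompactSupport
      hφc.smul_right).restrict _
  have m2 : MemLp (fun x => ∑ j : Fin 3, pd j φ x •
      maxwellSymbol (EuclideanSpace.single j 1) v) 2 (volume.restrict (exteriorOf K)) := by
    refine memLp_finsetSum _ fun j _ => MemLp.restrict _ ?_
    exact (by fun_prop : Continuous fun x => pd j φ x •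
      maxwellSymbol (EuclideanSpace.single j 1) v).memLp_of_hasCompactSupport
        (hφc.fderiv_apply ℝ (EuclideanSpace.single j 1)).smul_right
  let S : Set (HilbertOf K × HilbertOf K) :=
    {q | inner ℂ (m1.toLp _) q.2 = -inner ℂ (m2.toLp _) q.1}
  have hS : IsClosed S := isClosed_eq (by fun_prop) (by fun_prop)
  have e1 : ∀ q : HilbertOf K, inner ℂ (m1.toLp _) q =
      ∫ x in exteriorOf K, inner ℂ (φ x • v) (q x) := by
    intro q
    rw [L2.inner_def]
    refine integral_congr_ae ?_
    filter_upwards [m1.coeFn_toLp] with x hx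
    rw [hx]
  have e2 : ∀ q : HilbertOf K, inner ℂ (m2.toLp _) q =
      ∫ x in exteriorOf K, inner ℂ (∑ j : Fin 3, pd j φ x •
          maxwellSymbol (EuclideanSpace.single j 1) v) (q x) := by
    intro q
    rw [L2.inner_def]
    refine integral_congr_ae ?_
    filter_upwards [m2.coeFn_toLp] with x hx
    rw [hx]
  have hsub : (classicalGraph K N : Set (HilbertOf K × HilbertOf K)) ⊆ S := by
    rintro q ⟨f, hf, hf1, hf2⟩
    change inner ℂ (m1.toLp _) q.2 = -inner ℂ (m2.toLp _) q.1
    rw [e1, e2]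
    have h := classicalGraph_weak hφ hφc hφs v hf
    refine Eq.trans ?_ (h.trans ?_)
    · refine integral_congr_ae ?_
      filter_upwards [hf2] with x hx
      rw [hx]
    · refine congrArg Neg.neg (integral_congr_ae ?_)
      filter_upwards [hf1] with x hx
      rw [hx]
      rfl
  have hpS : inner ℂ (m1.toLp _) p.2 = -inner ℂ (m2.toLp _) p.1 := closure_minimal hsub hS hp
  rwa [e1, e2] at hpS

/-- The extension by zero of an element of `L²(Ω; ℂ⁶)`. -/
def zeroExt {K : Set R3} (g : HilbertOf K) : R3 → C6 := (exteriorOf K).indicator g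

lemma isOpen_exteriorOf (K : Set R3) : IsOpen (exteriorOf K) := isClosed_closure.isOpen_compl

lemma memLp_zeroExt {K : Set R3} (g : HilbertOf K) : MemLp (zeroExt g) 2 volume :=
  (memLp_indicator_iff_restrict (isOpen_exteriorOf K).measurableSet).2 (Lp.memLp g)

lemma locallyIntegrable_zeroExt {K : Set R3} (g : HilbertOf K) : LocallyIntegrable (zeroExt g) :=
  (memLp_zeroExt g).locallyIntegrable (by norm_num)

lemma setIntegral_inner_eq_inner_integral {K : Set R3} (g : HilbertOf K) (v : C6) (φ : R3 → ℝ)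
    (hφ : Continuous φ) (hφc : HasCompactSupport φ) :
    ∫ x in exteriorOf K, inner ℂ (φ x • v) (g x) = inner ℂ v (∫ x, φ x • zeroExt g x) := by
  rw [← integral_inner ((locallyIntegrable_zeroExt g).integrable_smul_left_of_hasCompactSupport
    hφ hφc), ← integral_indicator (isOpen_exteriorOf K).measurableSet]
  refine integral_congr_ae (Eventually.of_forall fun x => ?_)
  by_cases hx : x ∈ exteriorOf K
  · simp only [zeroExt, indicator_of_mem hx]
    rw [← Complex.coe_smul, inner_smul_left, ← Complex.coe_smul, inner_smul_right]
    simp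
  · simp [zeroExt, indicator_of_notMem hx]

/-- Pairing with an arbitrary `v` reduces the vector identity to the scalar one on the closed graph;
the symmetry of the symbol moves it from `v` to the integral. -/
lemma weakMaxwell_real {K : Set R3} {N : R3 → Submodule ℂ C6} {lam : ℂ} {g : HilbertOf K}
    (hg : (g, lam • g) ∈ (classicalGraph K N).topologicalClosure) {φ : R3 → ℝ}
    (hφ : ContDiff ℝ ∞ φ) (hφc : HasCompactSupport φ) (hφs : tsupport φ ⊆ exteriorOf K) :
    lam • ∫ y, φ y • zeroExt g y =
      -∑ j, maxwellSymbol (EuclideanSpace.single j 1) (∫ y, pd j φ y • zeroExt g y) := by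
  refine ext_inner_left ℂ fun v => ?_
  have h := closure_classicalGraph_weak hφ hφc hφs v hg
  have hc : ∀ j, HasCompactSupport (pd j φ) := fun j => hφc.fderiv_apply ℝ _
  have hd : ∀ j, Continuous (pd j φ) := fun j => (pd_contDiff j hφ).continuous
  have e1 : ∫ x in exteriorOf K, inner ℂ (φ x • v) ((lam • g : HilbertOf K) x) =
      lam * ∫ x in exteriorOf K, inner ℂ (φ x • v) (g x) := by
    rw [← integral_const_mul]
    refine integral_congr_ae ?_
    filter_upwards [Lp.coeFn_smul lam g] with x hx
    rw [hx, Pi.smul_apply, inner_smul_right]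
  have e2 : ∫ x in exteriorOf K, inner ℂ (∑ j : Fin 3, pd j φ x •
      maxwellSymbol (EuclideanSpace.single j 1) v) (g x) =
      ∑ j : Fin 3, ∫ x in exteriorOf K, inner ℂ (pd j φ x •
        maxwellSymbol (EuclideanSpace.single j 1) v) (g x) := by
    rw [← integral_finsetSum]
    · simp only [sum_inner]
    · intro j _
      have hl : Integrable (fun x => pd j φ x • inner ℂ
          (maxwellSymbol (EuclideanSpace.single j 1) v) (zeroExt g x)) := by
        refine LocallyIntegrable.integrable_smul_left_of_hasCompactSupport ?_ (hd j) (hc j)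
        exact ((memLp_zeroExt g).const_inner _).locallyIntegrable (by norm_num)
      refine (hl.integrableOn (s := exteriorOf K)).congr ?_
      filter_upwards [ae_restrict_mem (isOpen_exteriorOf K).measurableSet] with x hx
      rw [zeroExt, indicator_of_mem hx, ← Complex.coe_smul (pd j φ x)
        (maxwellSymbol (EuclideanSpace.single j 1) v), inner_smul_left]
      simp
  change ∫ x in exteriorOf K, inner ℂ (φ x • v) ((lam • g : HilbertOf K) x) =
    -∫ x in exteriorOf K, inner ℂ (∑ j : Fin 3, pd j φ x •
      maxwellSymbol (EuclideanSpace.single j 1) v) (g x) at h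
  rw [e1, e2, setIntegral_inner_eq_inner_integral g v φ hφ.continuous hφc] at h
  rw [inner_smul_right, h, inner_neg_right, inner_sum]
  refine congrArg Neg.neg (Finset.sum_congr rfl fun j _ => ?_)
  rw [setIntegral_inner_eq_inner_integral g _ _ (hd j) (hc j), inner_maxwellSymbol]

/-- Eigenfunctions of `G_b` solve the Maxwell system weakly in `Ω`. -/
lemma isWeakMaxwell_zeroExt {K : Set R3} {N : R3 → Submodule ℂ C6} {lam : ℂ} {g : HilbertOf K}
    (hg : (g, lam • g) ∈ (classicalGraph K N).topologicalClosure) :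
    IsWeakMaxwell lam (exteriorOf K) (zeroExt g) := by
  intro φ hφ hφc hφs
  -- The kernel `e^{λ s} / s` is complex, so complex test functions are needed; they are treated
  -- through real and imaginary parts.
  have parts : ∀ (L : ℂ →L[ℝ] ℝ), lam • ∫ y, L (φ y) • zeroExt g y =
      -∑ j, maxwellSymbol (EuclideanSpace.single j 1) (∫ y, L (pd j φ y) • zeroExt g y) := by
    intro L
    have hp : ∀ j y, pd j (fun y => L (φ y)) y = L (pd j φ y) := by
      intro j y
      have h : HasFDerivAt (fun y => L (φ y)) (L.comp (fderiv ℝ φ y)) y :=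
        L.hasFDerivAt.comp y (hφ.differentiable (by simp) y).hasFDerivAt
      rw [pd, h.fderiv]
      rfl
    have h := weakMaxwell_real hg (φ := fun y => L (φ y)) (L.contDiff.comp hφ)
      (hφc.comp_left (g := L) (map_zero L))
      ((tsupport_comp_subset (g := L) (map_zero L) φ).trans hφs)
    simpa only [hp] using h
  have split : ∀ ψ : R3 → ℂ, Continuous ψ → HasCompactSupport ψ → ∫ y, ψ y • zeroExt g y =
      (∫ y, Complex.reCLM (ψ y) • zeroExt g y) +
        Complex.I • ∫ y, Complex.imCLM (ψ y) • zeroExt g y := by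
    intro ψ hψ hψc
    have i : ∀ L : ℂ →L[ℝ] ℝ, Integrable fun y => L (ψ y) • zeroExt g y := fun L =>
      (locallyIntegrable_zeroExt g).integrable_smul_left_of_hasCompactSupport
        (L.continuous.comp hψ) (hψc.comp_left (g := L) (map_zero L))
    have i' : Integrable fun y => Complex.I • Complex.imCLM (ψ y) • zeroExt g y :=
      (i Complex.imCLM).smul Complex.I
    rw [← integral_smul, ← integral_add (i _) i']
    refine integral_congr_ae (Eventually.of_forall fun y => ?_)
    change ψ y • zeroExt g y = (ψ y).re • zeroExt g y + Complex.I • (ψ y).im • zeroExt g y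
    rw [← Complex.coe_smul (ψ y).re, ← Complex.coe_smul (ψ y).im, smul_smul, ← add_smul,
      mul_comm, Complex.re_add_im]
  have hs : ∀ j, ∫ y, pd j φ y • zeroExt g y = _ := fun j =>
    split _ (pd_contDiff j hφ).continuous (hφc.fderiv_apply ℝ _)
  rw [split φ hφ.continuous hφc, smul_add, smul_comm lam, parts, parts]
  simp only [hs, map_add, map_smul, Finset.sum_add_distrib, Finset.smul_sum, smul_neg, neg_add]

/-! ### Exponential decay -/

lemma pd_eventuallyEq {f g : R3 → ℂ} {y : R3} (h : f =ᶠ[𝓝 y] g) (j : Fin 3) :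
    pd j f =ᶠ[𝓝 y] pd j g := by
  filter_upwards [h.fderiv (𝕜 := ℝ)] with z hz
  rw [pd, pd, hz]

/-- Locality in `X` lets a product of cutoffs be replaced by whichever factor is not locally `1`. -/
lemma commKernel_congr (lam : ℂ) {X X' : R3 → ℂ} {y : R3} (h : X =ᶠ[𝓝 y] X') (ε : ℝ) (x : R3) :
    commKernel lam X ε x y = commKernel lam X' ε x y := by
  have h1 : ∀ j, pd j X y = pd j X' y := fun j => (pd_eventuallyEq h j).eq_of_nhds
  have h2 : lap X y = lap X' y := Finset.sum_congr rfl fun j _ =>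
    (pd_eventuallyEq (pd_eventuallyEq h j) j).eq_of_nhds
  simp only [commKernel, h1, h2]

/-- The constant in the bound of the kernel at distance at least `d`. -/
def kernelBound (lam : ℂ) (d : ℝ) : ℝ := d⁻¹ + 6 * (‖lam‖ * d⁻¹ + d⁻¹ ^ 2)

lemma kernelBound_nonneg (lam : ℂ) {d : ℝ} (hd : 0 < d) : 0 ≤ kernelBound lam d := by
  unfold kernelBound; positivity

/-- A coordinate difference is at most `s = ‖y - x‖` and cancels one inverse power; the remaining
ones are bounded by powers of `d⁻¹`. The `6` in `kernelBound` is the factor `2` times three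
coordinates. -/
lemma norm_commKernel_le (lam : ℂ) {X : R3 → ℂ} {M d : ℝ} (hd : 0 < d) {x y : R3}
    (hlap : ‖lap X y‖ ≤ M) (hpd : ∀ j, ‖pd j X y‖ ≤ M) (hxy : d ≤ ‖y - x‖) :
    ‖commKernel lam X 0 x y‖ ≤ M * kernelBound lam d * Real.exp (lam.re * ‖y - x‖) := by
  have hM : 0 ≤ M := (norm_nonneg _).trans hlap
  have hs : 0 < ‖y - x‖ := hd.trans_le hxy
  set s := ‖y - x‖ with hsdef
  set e := Real.exp (lam.re * s) with he
  have he0 : 0 < e := Real.exp_pos _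
  have hinv : s⁻¹ ≤ d⁻¹ := inv_anti₀ hd hxy
  have hinv0 : 0 ≤ s⁻¹ := by positivity
  have h1 : ‖prof lam s‖ ≤ e * d⁻¹ := by
    rw [prof, norm_mul, norm_exp_mul_ofReal, norm_inv, Complex.norm_real,
      Real.norm_of_nonneg hs.le]
    gcongr
  have h2 : ∀ j, ‖((y j - x j : ℝ) : ℂ) * prof₁ lam s‖ ≤ e * (‖lam‖ * d⁻¹ + d⁻¹ ^ 2) := by
    intro j
    have hj : |y j - x j| ≤ s := by
      have := PiLp.norm_apply_le (y - x) j
      simpa using this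
    have hn : ‖lam * (s : ℂ)⁻¹ ^ 2 - (s : ℂ)⁻¹ ^ 3‖ ≤ ‖lam‖ * s⁻¹ ^ 2 + s⁻¹ ^ 3 := by
      refine (norm_sub_le _ _).trans (le_of_eq ?_)
      simp [abs_of_pos hs]
    rw [norm_mul, Complex.norm_real, Real.norm_eq_abs, prof₁, norm_mul, norm_exp_mul_ofReal]
    calc |y j - x j| * (e * ‖lam * (s : ℂ)⁻¹ ^ 2 - (s : ℂ)⁻¹ ^ 3‖)
        ≤ s * (e * (‖lam‖ * s⁻¹ ^ 2 + s⁻¹ ^ 3)) := by gcongr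
      _ = e * (‖lam‖ * s⁻¹ + s⁻¹ ^ 2) := by field_simp
      _ ≤ _ := by gcongr
  rw [commKernel, regNorm_zero]
  refine (norm_add_le _ _).trans ?_
  have h3 : ‖lap X y * prof lam s‖ ≤ M * (e * d⁻¹) := by
    rw [norm_mul]
    gcongr
  have h4 : ‖2 * ∑ j, pd j X y * (((y j - x j : ℝ) : ℂ) * prof₁ lam s)‖ ≤
      2 * (3 * (M * (e * (‖lam‖ * d⁻¹ + d⁻¹ ^ 2)))) := by
    rw [norm_mul, Complex.norm_ofNat]
    refine mul_le_mul_of_nonneg_left ((norm_sum_le _ _).trans ?_) (by norm_num)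
    refine (Finset.sum_le_card_nsmul _ _ (M * (e * (‖lam‖ * d⁻¹ + d⁻¹ ^ 2))) fun j _ => ?_).trans
      (le_of_eq (by simp))
    rw [norm_mul]
    exact mul_le_mul (hpd j) (h2 j) (norm_nonneg _) hM
  refine (add_le_add h3 h4).trans (le_of_eq ?_)
  unfold kernelBound
  ring

/-- Compactness is asked of the derivative only, since the exterior cutoff equals `1` at infinity.
-/
lemma exists_derivative_bound {X : R3 → ℂ} (hX : ContDiff ℝ ∞ X)
    (hc : HasCompactSupport (fderiv ℝ X)) :
    ∃ M : ℝ, 0 ≤ M ∧ ∀ y, ‖lap X y‖ ≤ M ∧ ∀ j, ‖pd j X y‖ ≤ M := by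
  have h1 : ∃ C, ∀ y, ‖lap X y‖ ≤ C := HasCompactSupport.exists_bound_of_continuous
    (HasCompactSupport.intro hc fun y hy => lap_eq_zero_of_notMem hy) (lap_contDiff hX).continuous
  have h2 : ∀ j, ∃ C, ∀ y, ‖pd j X y‖ ≤ C := fun j =>
    HasCompactSupport.exists_bound_of_continuous
      (HasCompactSupport.intro hc fun y hy => pd_eq_zero_of_notMem_fderiv j hy)
      (pd_contDiff j hX).continuous
  obtain ⟨C, hC⟩ := h1
  choose D hD using h2
  have hC0 : 0 ≤ C := (norm_nonneg _).trans (hC 0)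
  have hD0 : ∀ j, 0 ≤ D j := fun j => (norm_nonneg _).trans (hD j 0)
  have hS : 0 ≤ ∑ j, D j := Finset.sum_nonneg fun j _ => hD0 j
  refine ⟨C + ∑ j, D j, by positivity, fun y => ⟨(hC y).trans (by linarith), fun j => ?_⟩⟩
  have := Finset.single_le_sum (fun j _ => hD0 j) (Finset.mem_univ j)
  linarith [hD j y]

lemma pd_comp_smul (j : Fin 3) (f : R3 → ℂ) (c : ℝ) (y : R3) :
    pd j (fun y => f (c • y)) y = c * pd j f (c • y) := by
  rw [pd, fderiv_comp_smul]
  simp [pd]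

lemma pd_const_mul (j : Fin 3) {f : R3 → ℂ} (c : ℂ) {y : R3} (hf : DifferentiableAt ℝ f y) :
    pd j (fun y => c * f y) y = c * pd j f y := by
  simp [pd, fderiv_const_mul hf]

/-- The chain rule produces factors `c` and `c²`, at most `1`; the bounds on the dilated cutoffs are
thus uniform in the dilation. -/
lemma derivative_bound_comp_smul {X : R3 → ℂ} (hX : ContDiff ℝ ∞ X) {M : ℝ}
    (hM : ∀ y, ‖lap X y‖ ≤ M ∧ ∀ j, ‖pd j X y‖ ≤ M) {c : ℝ} (hc0 : 0 ≤ c) (hc1 : c ≤ 1) (y : R3) :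
    ‖lap (fun y => X (c • y)) y‖ ≤ M ∧ ∀ j, ‖pd j (fun y => X (c • y)) y‖ ≤ M := by
  have hc2 : c * c ≤ 1 := by nlinarith
  constructor
  · have e : lap (fun y => X (c • y)) y = ((c * c : ℝ) : ℂ) * lap X (c • y) := by
      simp only [lap, Finset.mul_sum]
      refine Finset.sum_congr rfl fun j _ => ?_
      rw [show pd j (fun y => X (c • y)) = fun y => (c : ℂ) * pd j X (c • y) from
        funext fun y => pd_comp_smul j X c y, pd_const_mul, pd_comp_smul]
      · push_cast
        ring
      · exact ((pd_contDiff j hX).comp (contDiff_const_smul c)).differentiable (by simp) y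
    rw [e, norm_mul, Complex.norm_real, Real.norm_of_nonneg (by positivity)]
    exact (mul_le_of_le_one_left (norm_nonneg _) hc2).trans (hM _).1
  · intro j
    rw [pd_comp_smul, norm_mul, Complex.norm_real, Real.norm_of_nonneg hc0]
    exact (mul_le_of_le_one_left (norm_nonneg _) hc1).trans ((hM _).2 j)

/-- Comparison with `(1 + ‖z‖)⁻⁴`, integrable as `4 > 3`; the `24` is the `4!` of the exponential
series. -/
lemma integrable_exp_mul_norm {a : ℝ} (ha : a < 0) : Integrable fun z : R3 => Real.exp (a * ‖z‖) := by
  have h := integrable_one_add_norm (E := R3) (μ := volume) (r := 4)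
    (by norm_num [finrank_euclideanSpace])
  refine (h.const_mul (Real.exp (-a) * (24 / a ^ 4))).mono'
    (by fun_prop : Continuous fun z : R3 => Real.exp (a * ‖z‖)).aestronglyMeasurable
    (Eventually.of_forall fun z => ?_)
  have ha' := ha.ne
  have hz : 0 < 1 + ‖z‖ := by positivity
  have h1 := Real.pow_div_factorial_le_exp (-a * (1 + ‖z‖)) (mul_nonneg (by linarith) hz.le) 4
  rw [Real.norm_of_nonneg (Real.exp_pos _).le, Real.rpow_neg hz.le,
    show (1 + ‖z‖) ^ (4 : ℝ) = (1 + ‖z‖) ^ 4 by norm_cast, ← div_eq_mul_inv,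
    le_div_iff₀ (by positivity)]
  have h2 : a ^ 4 * (1 + ‖z‖) ^ 4 / 24 ≤ Real.exp (-a * (1 + ‖z‖)) := by
    refine le_trans (le_of_eq ?_) h1
    norm_num [Nat.factorial]
    ring
  calc Real.exp (a * ‖z‖) * (1 + ‖z‖) ^ 4
      = Real.exp (a * ‖z‖) * (a ^ 4 * (1 + ‖z‖) ^ 4 / 24) * (24 / a ^ 4) := by field_simp
    _ ≤ Real.exp (a * ‖z‖) * Real.exp (-a * (1 + ‖z‖)) * (24 / a ^ 4) := by gcongr
    _ = Real.exp (-a) * (24 / a ^ 4) := by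
      rw [← Real.exp_add]
      ring_nf

lemma memLp_exp_mul_norm {a : ℝ} (ha : a < 0) (x : R3) :
    MemLp (fun y : R3 => Real.exp (a * ‖y - x‖)) 2 volume := by
  have hc : Continuous fun y : R3 => Real.exp (a * ‖y - x‖) := by fun_prop
  rw [memLp_two_iff_integrable_sq hc.aestronglyMeasurable]
  have h := (integrable_exp_mul_norm (a := 2 * a) (by linarith)).comp_sub_right x
  refine h.congr (Eventually.of_forall fun y => ?_)
  simp only [← Real.exp_nat_mul]
  push_cast
  ring_nf

lemma tendsto_integral_indicator_norm_ge {h : R3 → ℝ} (hh : Integrable h) :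
    Tendsto (fun n : ℕ => ∫ y, {y : R3 | (n : ℝ) ≤ ‖y‖}.indicator h y) atTop (𝓝 0) := by
  have hm : ∀ n : ℕ, MeasurableSet {y : R3 | (n : ℝ) ≤ ‖y‖} := fun n =>
    (isClosed_le continuous_const continuous_norm).measurableSet
  rw [← integral_zero R3 ℝ (μ := volume)]
  refine tendsto_integral_of_dominated_convergence (fun y => ‖h y‖)
    (fun n => hh.aestronglyMeasurable.indicator (hm n)) hh.norm
    (fun n => Eventually.of_forall fun y => norm_indicator_le_norm_self _ _)
    (Eventually.of_forall fun y => ?_)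
  refine tendsto_const_nhds.congr' ?_
  obtain ⟨m, hm⟩ := exists_nat_gt ‖y‖
  filter_upwards [eventually_ge_atTop m] with n hn
  have : (m : ℝ) ≤ n := by exact_mod_cast hn
  exact (indicator_of_notMem (by simp only [mem_ofPred_eq, not_le]; linarith) _).symm

/-- Cauchy--Schwarz on a bounded set. -/
lemma setIntegral_norm_le {K : Set R3} (g : HilbertOf K) {S : Set R3} (hS : MeasurableSet S)
    (hSf : volume S ≠ ⊤) :
    ∫ y in S, ‖zeroExt g y‖ ≤ (volume.real S) ^ (1 / 2 : ℝ) * ‖g‖ := by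
  have h2 : ENNReal.ofReal 2 = 2 := by norm_num
  have hw := memLp_zeroExt g
  have hi : MemLp (S.indicator fun _ => (1 : ℝ)) (ENNReal.ofReal 2) volume :=
    memLp_indicator_const _ hS _ (Or.inr hSf)
  have h := integral_mul_le_Lp_mul_Lq_of_nonneg (μ := (volume : Measure R3))
    Real.HolderConjugate.two_two
    (f := S.indicator fun _ => (1 : ℝ)) (g := fun y => ‖zeroExt g y‖)
    (Eventually.of_forall fun y => indicator_nonneg (fun _ _ => zero_le_one) y)
    (Eventually.of_forall fun y => norm_nonneg _) hi (by rw [h2]; exact hw.norm)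
  have e1 : ∫ y, S.indicator (fun _ => (1 : ℝ)) y * ‖zeroExt g y‖ =
      ∫ y in S, ‖zeroExt g y‖ := by
    rw [← integral_indicator hS]
    refine integral_congr_ae (Eventually.of_forall fun y => ?_)
    by_cases hy : y ∈ S <;> simp [hy]
  have e2 : ∫ y, (S.indicator (fun _ => (1 : ℝ)) y) ^ (2 : ℝ) = volume.real S := by
    rw [← integral_indicator_one hS]
    refine integral_congr_ae (Eventually.of_forall fun y => ?_)
    by_cases hy : y ∈ S <;> simp [hy]
  have e3 : ‖g‖ = (∫ y, ‖zeroExt g y‖ ^ (2 : ℝ)) ^ (1 / 2 : ℝ) := by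
    have e : eLpNorm g 2 (volume.restrict (exteriorOf K)) = eLpNorm (zeroExt g) 2 volume :=
      (eLpNorm_indicator_eq_eLpNorm_restrict (isOpen_exteriorOf K).measurableSet).symm
    rw [Lp.norm_def, e, hw.eLpNorm_eq_integral_rpow_norm (by norm_num) (by norm_num),
      ENNReal.toReal_ofReal (by positivity)]
    norm_num
  rw [e1, e2, ← e3] at h
  exact h

/-- A smooth cutoff that vanishes near the ball of radius `ρ` and equals `1` off the ball of
radius `2ρ`. -/
lemma exists_exterior_cutoff {ρ : ℝ} (hρ : 0 < ρ) :
    ∃ χ : R3 → ℂ, ContDiff ℝ ∞ χ ∧ (∀ y ∈ tsupport χ, ρ < ‖y‖) ∧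
      (∀ y, 2 * ρ < ‖y‖ → χ y = 1) ∧ HasCompactSupport (fderiv ℝ χ) := by
  let b : ContDiffBump (0 : R3) := ⟨3 / 2 * ρ, 2 * ρ, by positivity, by linarith⟩
  have hone : ∀ y : R3, 2 * ρ < ‖y‖ → (1 - (b y : ℂ)) = 1 := fun y hy => by
    rw [b.zero_of_le_dist (by simpa [b] using hy.le)]
    simp
  refine ⟨fun y => 1 - (b y : ℂ), contDiff_const.sub (contDiff_ofReal_comp b.contDiff), ?_, hone, ?_⟩
  · have hsub : tsupport (fun y => 1 - (b y : ℂ)) ⊆ {y : R3 | 3 / 2 * ρ ≤ ‖y‖} := by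
      refine closure_minimal (fun y hy => ?_) (isClosed_le continuous_const continuous_norm)
      by_contra hn
      refine hy ?_
      have hn' : ‖y‖ ≤ 3 / 2 * ρ := (not_le.1 hn).le
      change 1 - (b y : ℂ) = 0
      rw [b.one_of_mem_closedBall (by simpa [b] using hn')]
      simp
    intro y hy
    have : 3 / 2 * ρ ≤ ‖y‖ := hsub hy
    linarith
  · refine HasCompactSupport.intro (isCompact_closedBall (0 : R3) (2 * ρ)) fun y hy => ?_
    have hy' : 2 * ρ < ‖y‖ := by simpa using hy
    refine image_eq_zero_of_notMem_tsupport (notMem_tsupport_fderiv (c := 1) ?_)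
    filter_upwards [(isOpen_lt continuous_const continuous_norm).mem_nhds hy'] with z hz
    exact hone z hz

/-- A smooth compactly supported function that equals `1` on the open unit ball. -/
lemma exists_unit_cutoff : ∃ θ : R3 → ℂ, ContDiff ℝ ∞ θ ∧ HasCompactSupport θ ∧
    ∀ y, ‖y‖ < 1 → θ y = 1 := by
  let b : ContDiffBump (0 : R3) := ⟨1, 2, by positivity, by norm_num⟩
  refine ⟨fun y => (b y : ℂ), contDiff_ofReal_comp b.contDiff,
    b.hasCompactSupport.comp_left (g := fun t : ℝ => (t : ℂ)) rfl, fun y hy => ?_⟩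
  change (b y : ℂ) = 1
  rw [b.one_of_mem_closedBall (by simpa [b] using hy.le)]
  simp

/-- Weak solutions in `L²` of the Helmholtz equation in the exterior of a ball decay exponentially,
almost everywhere. -/
lemma exists_ae_decay {ρ : ℝ} (hρ : 0 < ρ) {lam : ℂ} (hlam : lam.re < 0) :
    ∃ C : ℝ, ∀ (K : Set R3), K ⊆ Metric.closedBall 0 ρ → ∀ g : HilbertOf K,
      IsWeakHelmholtz (lam ^ 2) (exteriorOf K) (zeroExt g) →
      ∀ᵐ x, 5 / 2 * ρ < ‖x‖ → ‖zeroExt g x‖ ≤ C * Real.exp (lam.re * ‖x‖) * ‖g‖ := by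
  obtain ⟨χ, hχ, hχs, hχ1, hχc⟩ := exists_exterior_cutoff hρ
  obtain ⟨θ, hθ, hθc, hθ1⟩ := exists_unit_cutoff
  obtain ⟨M, hM0, hM⟩ := exists_derivative_bound hχ hχc
  obtain ⟨M', hM'0, hM'⟩ := exists_derivative_bound hθ (hθc.fderiv ℝ)
  set S : Set R3 := Metric.closedBall 0 (2 * ρ) with hS
  have hSm : MeasurableSet S := Metric.isClosed_closedBall.measurableSet
  have hSf : volume S ≠ ⊤ := (isCompact_closedBall _ _).measure_ne_top
  -- The distance `ρ / 2` is `5ρ/2 - 2ρ`, the gap between `x` and the ball carrying `∇χ`. The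
  -- exponential comes from `‖y - x‖ ≥ ‖x‖ - 2ρ`, the root of the volume from Cauchy–Schwarz.
  refine ⟨kernelMass⁻¹ * (M * kernelBound lam (ρ / 2) * Real.exp (-lam.re * (2 * ρ)) *
    (volume.real S) ^ (1 / 2 : ℝ)), fun K hK g hweak => ?_⟩
  have hw := locallyIntegrable_zeroExt g
  have hext : ∀ y : R3, ρ < ‖y‖ → y ∈ exteriorOf K := fun y hy hyK => by
    have := closure_minimal hK Metric.isClosed_closedBall hyK
    rw [mem_closedBall_zero_iff] at this
    linarith
  let X : ℕ → R3 → ℂ := fun n y => χ y * θ ((n : ℝ)⁻¹ • y)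
  have hθn : ∀ n : ℕ, ContDiff ℝ ∞ fun y => θ ((n : ℝ)⁻¹ • y) := fun n =>
    hθ.comp (contDiff_const_smul _)
  have hX : ∀ n, ContDiff ℝ ∞ (X n) := fun n => hχ.mul (hθn n)
  have hXc : ∀ n : ℕ, n ≠ 0 → HasCompactSupport (X n) := fun n hn =>
    (hθc.comp_smul (inv_ne_zero (by exact_mod_cast hn))).mul_left
  have hXs : ∀ n, tsupport (X n) ⊆ exteriorOf K := fun n y hy =>
    hext y (hχs y (tsupport_mul_subset_left hy))
  have hθloc : ∀ n : ℕ, n ≠ 0 → ∀ y : R3, ‖y‖ < n → θ ((n : ℝ)⁻¹ • y) = 1 := fun n hn y hy => by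
    have hn' : (0 : ℝ) < n := by positivity
    refine hθ1 _ ?_
    rw [norm_smul, norm_inv, Real.norm_of_nonneg hn'.le, inv_mul_lt_iff₀ hn', mul_one]
    exact hy
  -- One null set must serve all cutoffs, so that `n → ∞` can be taken at a fixed `x`.
  have hae := ae_all_iff.2 fun n : ℕ => ae_all_iff.2 fun hn : n ≠ 0 =>
    ae_eq_integral_commKernel hlam hw hweak (hX n) (hXc n hn) (hXs n)
  filter_upwards [hae] with x hx hxρ
  set A : ℝ := M * kernelBound lam (ρ / 2) * Real.exp (lam.re * (‖x‖ - 2 * ρ)) with hA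
  set B : ℝ := M' * kernelBound lam 1 with hB
  have hA0 : 0 ≤ A := mul_nonneg (mul_nonneg hM0 (kernelBound_nonneg lam (by positivity)))
    (Real.exp_pos _).le
  have hB0 : 0 ≤ B := mul_nonneg hM'0 (kernelBound_nonneg lam one_pos)
  -- Majorant of the far part, independent of `n` and integrable as a product of two L² functions.
  let h : R3 → ℝ := fun y => B * (Real.exp (lam.re * ‖y - x‖) * ‖zeroExt g y‖)
  have hh : Integrable h :=
    ((memLp_exp_mul_norm hlam x).integrable_mul (memLp_zeroExt g).norm).const_mul B
  -- For `‖y‖ ≥ n` only `θ` varies, and `y` is at distance at least `1` from `x`; for `‖y‖ < n` only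
  -- `χ` varies, and it is constant beyond radius `2ρ`.
  have hkernel : ∀ n : ℕ, ‖x‖ + 1 ≤ n → ∀ y, ‖commKernel lam (X n) 0 x y • zeroExt g y‖ ≤
      S.indicator (fun y => A * ‖zeroExt g y‖) y + {y : R3 | (n : ℝ) ≤ ‖y‖}.indicator h y := by
    intro n hn y
    have hn0 : n ≠ 0 := by
      rintro rfl
      have := norm_nonneg x
      norm_num at hn
      linarith
    rw [norm_smul]
    have hh0 : 0 ≤ h y := by positivity
    have i1 : 0 ≤ S.indicator (fun y => A * ‖zeroExt g y‖) y :=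
      indicator_nonneg (fun y _ => by positivity) y
    have i2 : 0 ≤ {y : R3 | (n : ℝ) ≤ ‖y‖}.indicator h y :=
      indicator_nonneg (fun y _ => by positivity) y
    by_cases hy : (n : ℝ) ≤ ‖y‖
    · have hloc : X n =ᶠ[𝓝 y] fun y => θ ((n : ℝ)⁻¹ • y) := by
        have : 2 * ρ < ‖y‖ := by linarith
        filter_upwards [(isOpen_lt continuous_const continuous_norm).mem_nhds this] with z hz
        simp only [X, hχ1 z hz, one_mul]
      have hinv : (n : ℝ)⁻¹ ≤ 1 := inv_le_one_of_one_le₀ (by linarith [norm_nonneg x])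
      have hb := derivative_bound_comp_smul hθ hM' (by positivity : (0 : ℝ) ≤ (n : ℝ)⁻¹) hinv y
      have hd : 1 ≤ ‖y - x‖ := by linarith [norm_sub_norm_le y x]
      have hk := norm_commKernel_le lam one_pos hb.1 hb.2 hd
      rw [commKernel_congr lam hloc, indicator_of_mem (s := {y : R3 | (n : ℝ) ≤ ‖y‖}) hy]
      refine le_trans ?_ (le_add_of_nonneg_left i1)
      refine (mul_le_mul_of_nonneg_right hk (norm_nonneg _)).trans (le_of_eq ?_)
      simp only [h, hB]
      ring
    · have hloc : X n =ᶠ[𝓝 y] χ := by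
        filter_upwards [(isOpen_lt continuous_norm continuous_const).mem_nhds (not_le.1 hy)]
          with z hz
        simp only [X, hθloc n hn0 z hz, mul_one]
      rw [commKernel_congr lam hloc]
      by_cases hyS : ‖y‖ ≤ 2 * ρ
      · have hd : ‖x‖ - 2 * ρ ≤ ‖y - x‖ := by
          rw [norm_sub_rev]
          linarith [norm_sub_norm_le x y]
        have hk := norm_commKernel_le lam (by positivity : 0 < ρ / 2) (hM y).1 (hM y).2
          (by linarith : ρ / 2 ≤ ‖y - x‖)
        rw [indicator_of_mem (s := S) (by simpa [hS] using hyS)]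
        refine le_trans ?_ (le_add_of_nonneg_right i2)
        refine mul_le_mul_of_nonneg_right (hk.trans ?_) (norm_nonneg _)
        refine mul_le_mul_of_nonneg_left (Real.exp_le_exp.2 ?_)
          (mul_nonneg hM0 (kernelBound_nonneg lam (by positivity)))
        exact mul_le_mul_of_nonpos_left hd hlam.le
      · rw [commKernel_eq_zero (notMem_tsupport_fderiv (c := 1) ?_)]
        · simpa using add_nonneg i1 i2
        · filter_upwards [(isOpen_lt continuous_const continuous_norm).mem_nhds (not_le.1 hyS)]
            with z hz
          exact hχ1 z hz
  have hSint : Integrable (S.indicator fun y => A * ‖zeroExt g y‖) := by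
    rw [integrable_indicator_iff hSm]
    exact ((hw.integrableOn_isCompact (isCompact_closedBall _ _)).norm).const_mul A
  have hbound : ∀ᶠ n : ℕ in atTop, kernelMass * ‖zeroExt g x‖ ≤
      (A * ∫ y in S, ‖zeroExt g y‖) + ∫ y, {y : R3 | (n : ℝ) ≤ ‖y‖}.indicator h y := by
    obtain ⟨m, hm⟩ := exists_nat_gt (‖x‖ + 1)
    filter_upwards [eventually_ge_atTop m] with n hnm
    have hn : ‖x‖ + 1 ≤ n := hm.le.trans (by exact_mod_cast hnm)
    have hn0 : n ≠ 0 := by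
      rintro rfl
      have := norm_nonneg x
      norm_num at hn
      linarith
    have hX1 : X n =ᶠ[𝓝 x] fun _ => 1 := by
      filter_upwards [(isOpen_lt continuous_const continuous_norm).mem_nhds
        (by linarith : 2 * ρ < ‖x‖), (isOpen_lt continuous_norm continuous_const).mem_nhds
        (by linarith : ‖x‖ < n)] with z hz hz'
      simp only [X, hχ1 z hz, hθloc n hn0 z hz', mul_one]
    have hrep := congrArg norm (hx n hn0 (notMem_tsupport_fderiv hX1))
    rw [hX1.eq_of_nhds, one_smul, norm_smul, Complex.norm_real,
      Real.norm_of_nonneg kernelMass_pos.le] at hrep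
    have hm' : MeasurableSet {y : R3 | (n : ℝ) ≤ ‖y‖} :=
      (isClosed_le continuous_const continuous_norm).measurableSet
    rw [hrep]
    refine (norm_integral_le_of_norm_le (hSint.add (hh.indicator hm'))
      (Eventually.of_forall (hkernel n hn))).trans (le_of_eq ?_)
    rw [← integral_const_mul, ← integral_indicator hSm]
    exact integral_add hSint (hh.indicator hm')
  have hlim := (tendsto_integral_indicator_norm_ge hh).const_add (A * ∫ y in S, ‖zeroExt g y‖)
  have hfin := ge_of_tendsto hlim hbound
  rw [add_zero] at hfin
  have hcs := hfin.trans (mul_le_mul_of_nonneg_left (setIntegral_norm_le g hSm hSf) hA0)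
  rw [← le_inv_mul_iff₀ kernelMass_pos] at hcs
  refine hcs.trans (le_of_eq ?_)
  rw [hA, show lam.re * (‖x‖ - 2 * ρ) = -lam.re * (2 * ρ) + lam.re * ‖x‖ by ring, Real.exp_add]
  ring

/-- A pointwise bound that holds a.e. on an open set extends to continuous functions. -/
lemma le_of_ae_le_of_continuousOn {U : Set R3} (hU : IsOpen U) {f h : R3 → ℝ}
    (hf : ContinuousOn f U) (hh : ContinuousOn h U) (hle : ∀ᵐ x, x ∈ U → f x ≤ h x) :
    ∀ x ∈ U, f x ≤ h x := by
  intro x hx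
  -- Taking the maximum turns the a.e. inequality into an a.e. equality of continuous functions.
  have e : EqOn (fun x => max (f x) (h x)) h U := by
    refine Measure.eqOn_open_of_ae_eq (μ := volume) ?_ hU (hf.sup hh) hh
    rw [EventuallyEq, ae_restrict_iff' hU.measurableSet]
    filter_upwards [hle] with y hy hyU
    exact max_eq_right (hy hyU)
  exact max_eq_right_iff.1 (e hx)

end

/-! ### Combination of interior regularity and almost everywhere decay -/

theorem mainTheorem5 (ρ : ℝ) (hρ : 0 < ρ) (lam : ℂ) (hlam : lam.re < 0) :
    ∃ C : ℝ, ∀ (K : Set R3), IsOpen K → K ⊆ Metric.closedBall 0 ρ → HasSmoothBoundary K →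
      ∀ (N : R3 → Submodule ℂ C6), IsSmoothBoundaryBundle K N → IsMaximalDissipative K N →
      ∀ g : (maxwellGb K N).domain, maxwellGb K N g = lam • (g : HilbertOf K) →
      ∃ g' : R3 → C6, ContinuousOn g' (exteriorOf K) ∧
        (g : HilbertOf K) =ᵐ[volume.restrict (exteriorOf K)] g' ∧
        (∀ x : R3, 3 * ρ ≤ ‖x‖ →
          ‖g' x‖ ≤ C * Real.exp (lam.re * ‖x‖) * ‖(g : HilbertOf K)‖) ∧
        g' =O[Bornology.cobounded R3] fun x => Real.exp (lam.re * ‖x‖) := by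
  obtain ⟨C, hC⟩ := exists_ae_decay hρ hlam
  refine ⟨C, fun K _ hK _ N _ _ g hg => ?_⟩
  have hgraph : ((g : HilbertOf K), lam • (g : HilbertOf K)) ∈
      (classicalGraph K N).topologicalClosure := by
    rw [← maxwellGb_graph, ← hg]
    exact (maxwellGb K N).mem_graph g
  have hlam0 : lam ≠ 0 := fun h => by simp [h] at hlam
  have hweak := (isWeakMaxwell_zeroExt hgraph).isWeakHelmholtz hlam0
    (locallyIntegrable_zeroExt (g : HilbertOf K))
  have hΩ := isOpen_exteriorOf K
  obtain ⟨g', hg', hae⟩ := exists_continuousOn_ae_eq_of_local hΩ fun x₀ hx₀ =>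
    exists_local_continuous_representative hlam hΩ
      (locallyIntegrable_zeroExt (g : HilbertOf K)) hweak hx₀
  have hext : ∀ y : R3, ρ < ‖y‖ → y ∈ exteriorOf K := fun y hy hyK => by
    have := closure_minimal hK Metric.isClosed_closedBall hyK
    rw [mem_closedBall_zero_iff] at this
    linarith
  have hbound : ∀ x : R3, 3 * ρ ≤ ‖x‖ →
      ‖g' x‖ ≤ C * Real.exp (lam.re * ‖x‖) * ‖(g : HilbertOf K)‖ := by
    intro x hx
    -- The a.e. bound holds on an open set containing the closed region `‖x‖ ≥ 3ρ`, so continuity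
    -- gives it at every point, the sphere `‖x‖ = 3ρ` included.
    refine le_of_ae_le_of_continuousOn (U := {x : R3 | 5 / 2 * ρ < ‖x‖})
      (f := fun x => ‖g' x‖)
      (h := fun x => C * Real.exp (lam.re * ‖x‖) * ‖(g : HilbertOf K)‖)
      (isOpen_lt continuous_const continuous_norm) ?_ ?_ ?_ x ?_
    · refine (hg'.mono fun y hy => hext y ?_).norm
      have : 5 / 2 * ρ < ‖y‖ := hy
      linarith
    · exact Continuous.continuousOn (by fun_prop)
    · filter_upwards [hae, hC K hK g hweak] with y h1 h2 hy
      have hy' : 5 / 2 * ρ < ‖y‖ := hy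
      rw [← h1 (hext y (by linarith))]
      exact h2 hy'
    · change 5 / 2 * ρ < ‖x‖
      linarith
  refine ⟨g', hg', ?_, hbound, ?_⟩
  · rw [EventuallyEq, ae_restrict_iff' hΩ.measurableSet]
    filter_upwards [hae] with x hx hxΩ
    rw [← hx hxΩ, zeroExt, indicator_of_mem hxΩ]
  · refine Asymptotics.IsBigO.of_bound (C * ‖(g : HilbertOf K)‖) ?_
    filter_upwards [tendsto_norm_cobounded_atTop.eventually_ge_atTop (3 * ρ)] with x hx
    rw [Real.norm_of_nonneg (Real.exp_pos _).le]
    refine (hbound x hx).trans (le_of_eq ?_)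
    ring
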